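/- For an integer $m\ge 1$ and rational matrices $A^1,\dots,A^m\in\mathbb{Q}^{n\times n}$ let $$Z_m(A^1,\dots,A^m)=\sum_{S\subseteq[n]}\ \prod_{i=1}^m\det(A^i_{S,S}),$$ where $A_{S,S}$ is the principal submatrix of $A$ indexed by $S$ and $\det(A_{\emptyset,\emptyset})=1$. Let $\mathcal K$ be either the class of positive semi-definite rational matrices or the class of rational $P_0$-matrices (all principal minors are nonnegative). An input $I$ for $Z_m$ on $\mathcal K$ consists of $m$ matrices in $\mathcal K$ of the same order $n$; its size $|I|$ is the number of bits of its standard binary representation. Algorithms are programs for a unit-cost random-access machine over the rationals with fair coin flips; the running time is the number of elementary operations, and all numbers that an algorithm handles are required to have a number of bits polynomial in the bit length of its input (and in $\varepsilon^{-1}$ if an error tolerance $\varepsilon$ is a part of the input). Time and bit bounds hold for every outcome of the coin flips. An FPRAS for $Z_m$ on $\mathcal K$ is a randomized algorithm that, given an input $I$ and a rational $\varepsilon\in(0,1)$, runs in time polynomial in $|I|$ and $\varepsilon^{-1}$ and outputs with probability at least $\frac34$ a number $\widehat Z$ with $e^{-\varepsilon}Z_m(I)\le\widehat Z\le e^{\varepsilon}Z_m(I)$.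 For a function $\rho$ of the order $n$, a $\rho$-approximation randomized algorithm for $Z_m$ on $\mathcal K$ is a randomized algorithm that, given an input $I$ with matrices of order $n$, runs in time polynomial in $|I|$ and outputs with probability at least $\frac34$ a number $\widehat Z$ with $Z_m(I)\le\widehat Z\le\rho(n)\,Z_m(I)$. **Theorem.** For each fixed integer $m\ge1$ and each of the two classes $\mathcal K$, at least one of the following two statements holds: - there exists an FPRAS for $Z_m$ on $\mathcal K$, or - for every real $\delta\in(0,1)$, there does not exist a $2^{n^\delta}$-approximation randomized algorithm for $Z_m$ on $\mathcal K$. -/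

import Mathlib

open MeasureTheory

/-- The bit size `1 + ⌈log₂(|p|+1)⌉ + ⌈log₂(|q|+1)⌉` of a rational number `p/q` in lowest terms. -/
def ratSize (x : ℚ) : ℕ :=
  1 + Nat.clog 2 (x.num.natAbs + 1) + Nat.clog 2 (x.den + 1)

/-- The bit size of a rational matrix of order `n`: `n²` plus the sizes of its entries. -/
def matSize {n : ℕ} (A : Matrix (Fin n) (Fin n) ℚ) : ℕ :=
  n * n + ∑ i, ∑ j, ratSize (A i j)

/-! ### A randomized unit-cost random-access machine over the rationals

The memory consists of countably many banks; each bank is an infinite array of cells that hold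
rational numbers. A program names banks statically and addresses the cells of a bank
indirectly, by the value of an expression. The time counts elementary operations, and the
machine also records the largest bit size of a number that it handles. -/

/-- `Memory`: the content of cell `k` of bank `a` is `M a k`. -/
abbrev Memory := ℕ → ℕ → ℚ

/-- Arithmetic expressions with indirect addressing. -/
inductive Expr where
  | const (q : ℚ)
  | read (a : ℕ) (i : Expr)
  | add (e f : Expr)
  | sub (e f : Expr)
  | mul (e f : Expr)
  | div (e f : Expr)
  | floor (e : Expr)

namespace Expr

/-- The value of an expression. Addresses are rounded down to natural numbers, and division
by zero gives zero. -/
def eval (M : Memory) : Expr → ℚ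
  | const q => q
  | read a i => M a ⌊i.eval M⌋₊
  | add e f => e.eval M + f.eval M
  | sub e f => e.eval M - f.eval M
  | mul e f => e.eval M * f.eval M
  | div e f => e.eval M / f.eval M
  | floor e => (⌊e.eval M⌋ : ℚ)

/-- The number of unit-cost operations that the evaluation of an expression takes. -/
def cost : Expr → ℕ
  | const _ => 1
  | read _ i => i.cost + 1
  | add e f => e.cost + f.cost + 1
  | sub e f => e.cost + f.cost + 1
  | mul e f => e.cost + f.cost + 1
  | div e f => e.cost + f.cost + 1
  | floor e => e.cost + 1

/-- The largest bit size of a number that appears in the evaluation of an expression,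
all intermediate results included. -/
def bits (M : Memory) : Expr → ℕ
  | const q => ratSize q
  | read a i => max (i.bits M) (ratSize ((read a i).eval M))
  | add e f => max (max (e.bits M) (f.bits M)) (ratSize ((add e f).eval M))
  | sub e f => max (max (e.bits M) (f.bits M)) (ratSize ((sub e f).eval M))
  | mul e f => max (max (e.bits M) (f.bits M)) (ratSize ((mul e f).eval M))
  | div e f => max (max (e.bits M) (f.bits M)) (ratSize ((div e f).eval M))
  | floor e => max (e.bits M) (ratSize ((floor e).eval M))

end Expr

/-- Programs. `assign a i e` writes the value of `e` into the cell with address `i` of bank `a`;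
`flip a i` writes a fair random bit there; the tests have the form `e < f`. -/
inductive Prog where
  | skip
  | assign (a : ℕ) (i e : Expr)
  | flip (a : ℕ) (i : Expr)
  | seq (p q : Prog)
  | ite (e f : Expr) (p q : Prog)
  | while (e f : Expr) (p : Prog)

/-- A state of the machine: the memory and the random bits that have not been used so far. -/
structure MState where
  mem : Memory
  coins : ℕ → Bool

/-- Change one memory cell. -/
def Memory.write (M : Memory) (a k : ℕ) (x : ℚ) : Memory :=
  fun a' k' => if a' = a ∧ k' = k then x else M a' k'

/-- `Exec p s t b s'`: started in state `s`, the program `p` halts in state `s'` after `t`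
elementary operations, and the largest bit size of a number that it handles is `b`. For a given
state `s` there is at most one such triple `(t, b, s')`, and none if `p` does not halt. -/
inductive Exec : Prog → MState → ℕ → ℕ → MState → Prop where
  | skip (s : MState) : Exec .skip s 1 0 s
  | assign (a : ℕ) (i e : Expr) (s : MState) :
      Exec (.assign a i e) s (i.cost + e.cost + 1) (max (i.bits s.mem) (e.bits s.mem))
        ⟨s.mem.write a ⌊i.eval s.mem⌋₊ (e.eval s.mem), s.coins⟩
  | flip (a : ℕ) (i : Expr) (s : MState) :
      Exec (.flip a i) s (i.cost + 1) (max (i.bits s.mem) (ratSize 1))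
        ⟨s.mem.write a ⌊i.eval s.mem⌋₊ (if s.coins 0 then 1 else 0), fun k => s.coins (k + 1)⟩
  | seq {p q : Prog} {s s₁ s₂ : MState} {t₁ t₂ b₁ b₂ : ℕ} :
      Exec p s t₁ b₁ s₁ → Exec q s₁ t₂ b₂ s₂ →
      Exec (.seq p q) s (t₁ + t₂) (max b₁ b₂) s₂
  | iteTrue {e f : Expr} {p q : Prog} {s s' : MState} {t b : ℕ} :
      e.eval s.mem < f.eval s.mem → Exec p s t b s' →
      Exec (.ite e f p q) s (e.cost + f.cost + 1 + t)
        (max (max (e.bits s.mem) (f.bits s.mem)) b) s'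
  | iteFalse {e f : Expr} {p q : Prog} {s s' : MState} {t b : ℕ} :
      ¬ e.eval s.mem < f.eval s.mem → Exec q s t b s' →
      Exec (.ite e f p q) s (e.cost + f.cost + 1 + t)
        (max (max (e.bits s.mem) (f.bits s.mem)) b) s'
  | whileTrue {e f : Expr} {p : Prog} {s s₁ s₂ : MState} {t₁ t₂ b₁ b₂ : ℕ} :
      e.eval s.mem < f.eval s.mem → Exec p s t₁ b₁ s₁ → Exec (.while e f p) s₁ t₂ b₂ s₂ →
      Exec (.while e f p) s (e.cost + f.cost + 1 + t₁ + t₂)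
        (max (max (e.bits s.mem) (f.bits s.mem)) (max b₁ b₂)) s₂
  | whileFalse {e f : Expr} {p : Prog} {s : MState} :
      ¬ e.eval s.mem < f.eval s.mem →
      Exec (.while e f p) s (e.cost + f.cost + 1) (max (e.bits s.mem) (f.bits s.mem)) s

/-- The result of an execution is unique. -/
theorem Exec.deterministic {p s t b s' t2 b2 s2} (h : Exec p s t b s') (h2 : Exec p s t2 b2 s2) :
    t = t2 ∧ b = b2 ∧ s' = s2 := by
  induction h generalizing t2 b2 s2 with
  | skip s => cases h2; simp
  | assign => cases h2; simp
  | flip => cases h2; simp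
  | seq _ _ ih1 ih2 =>
    cases h2 with
    | seq a b => obtain ⟨rfl, rfl, rfl⟩ := ih1 a; obtain ⟨rfl, rfl, rfl⟩ := ih2 b; simp
  | iteTrue h _ ih =>
    cases h2 with
    | iteTrue h' a => obtain ⟨rfl, rfl, rfl⟩ := ih a; simp
    | iteFalse h' a => exact absurd h h'
  | iteFalse h _ ih =>
    cases h2 with
    | iteTrue h' a => exact absurd h' h
    | iteFalse h' a => obtain ⟨rfl, rfl, rfl⟩ := ih a; simp
  | whileTrue h _ _ ih1 ih2 =>
    cases h2 with
    | whileTrue h' a b => obtain ⟨rfl, rfl, rfl⟩ := ih1 a; obtain ⟨rfl, rfl, rfl⟩ := ih2 b; simp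
    | whileFalse h' => exact absurd h h'
  | whileFalse h =>
    cases h2 with
    | whileTrue h' a b => exact absurd h' h
    | whileFalse h' => simp

/-- The law of an infinite sequence of independent fair coin flips. -/
noncomputable def coinLaw : Measure (ℕ → Bool) :=
  Measure.infinitePi fun _ : ℕ => (PMF.uniformOfFintype Bool).toMeasure

/-- Started on memory `M` with the random bits `ω`, the program `p` halts within `T` elementary
operations, and the numbers that it handles have at most `B` bits. -/
def HaltsWithin (p : Prog) (M : Memory) (ω : ℕ → Bool) (T B : ℝ) : Prop :=
  ∃ t b s, Exec p ⟨M, ω⟩ t b s ∧ (t : ℝ) ≤ T ∧ (b : ℝ) ≤ B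

/-- The event that the program `p`, started on memory `M`, halts with an output `y`
(the content of cell `0` of bank `0`) with `l ≤ y ≤ u`. -/
def outputBetween (p : Prog) (M : Memory) (l u : ℝ) : Set (ℕ → Bool) :=
  {ω | ∃ t b s, Exec p ⟨M, ω⟩ t b s ∧ l ≤ (s.mem 0 0 : ℝ) ∧ (s.mem 0 0 : ℝ) ≤ u}

/-! ### Normalizing constants of products of determinantal point processes -/

/-- `Z_m(A¹, …, Aᵐ) = ∑_{S ⊆ [n]} ∏_{i ∈ [m]} det(Aⁱ_{S,S})`. -/
def normConst {m n : ℕ} (A : Fin m → Matrix (Fin n) (Fin n) ℚ) : ℚ :=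
  ∑ S : Finset (Fin n), ∏ i, ((A i).submatrix (Subtype.val : S → Fin n) Subtype.val).det

/-- A class of rational square matrices. -/
abbrev MatrixClass := ∀ n : ℕ, Matrix (Fin n) (Fin n) ℚ → Prop

/-- Positive semi-definite rational matrices. -/
def psdClass : MatrixClass := fun _ A => (A.map (Rat.cast : ℚ → ℝ)).PosSemidef

/-- P₀-matrices: all principal minors are nonnegative. -/
def pZeroClass : MatrixClass := fun n A =>
  ∀ S : Finset (Fin n), 0 ≤ (A.submatrix (Subtype.val : S → Fin n) Subtype.val).det

/-- An input for `Z_m`: `m` matrices of the class `K`, of the same order. -/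
structure ZInput (K : MatrixClass) (m : ℕ) where
  order : ℕ
  mat : Fin m → Matrix (Fin order) (Fin order) ℚ
  mem_class : ∀ i, K order (mat i)

namespace ZInput

variable {K : MatrixClass} {m : ℕ}

/-- The bit size of the input. -/
def size (I : ZInput K m) : ℕ := ∑ i, matSize (I.mat i)

/-- The value `Z_m(A¹, …, Aᵐ)`. -/
def value (I : ZInput K m) : ℚ := normConst I.mat

/-- The initial memory: cell `0` of bank `0` holds the order `n`, cell `1` of bank `0` holds the
parameter `ε`, bank `i` holds the `i`-th matrix row by row for `1 ≤ i ≤ m`, and every other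
cell holds `0`. -/
def load (I : ZInput K m) (ε : ℚ) : Memory
  | 0, 0 => I.order
  | 0, 1 => ε
  | 0, _ + 2 => 0
  | a + 1, k =>
    if h : a < m ∧ k < I.order * I.order then
      I.mat ⟨a, h.1⟩ ⟨k / I.order, Nat.div_lt_of_lt_mul h.2⟩
        ⟨k % I.order, Nat.mod_lt _ (Nat.pos_of_mul_pos_left (Nat.zero_lt_of_lt h.2))⟩
    else 0

end ZInput

/-- There is an FPRAS for `Z_m` on matrices of the class `K`: a randomized algorithm that takes
an input `I` and an error tolerance `ε ∈ (0,1)`, outputs with probability at least `3/4` a number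
between `e^{-ε} Z_m(I)` and `e^ε Z_m(I)`, and always halts in time polynomial in the size of `I`
and `ε⁻¹`; the numbers that it handles have a number of bits that is polynomial
in these quantities and the size of `ε`, which is a part of the input. -/
def HasFPRAS (K : MatrixClass) (m : ℕ) : Prop :=
  ∃ (p : Prog) (c d : ℕ), ∀ (I : ZInput K m) (ε : ℚ), 0 < ε → ε < 1 →
    (∀ ω, HaltsWithin p (I.load ε) ω
      (c * ((I.size : ℝ) + (ε : ℝ)⁻¹ + 1) ^ d)
      (c * ((I.size : ℝ) + (ratSize ε : ℝ) + (ε : ℝ)⁻¹ + 1) ^ d)) ∧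
    3 / 4 ≤ coinLaw (outputBetween p (I.load ε)
      (Real.exp (-(ε : ℝ)) * (I.value : ℝ)) (Real.exp (ε : ℝ) * (I.value : ℝ)))

/-- There is a (polynomial-time) `ρ`-approximation randomized algorithm for `Z_m` on matrices of
the class `K`, where `ρ` is a function of the order of the matrices: it always halts in time
polynomial in the size of the input, the numbers that it handles have polynomially many bits,
and with probability at least `3/4` its output lies between `Z_m(I)` and `ρ(n) Z_m(I)`. -/
def HasApprox (K : MatrixClass) (m : ℕ) (ρ : ℕ → ℝ) : Prop :=
  ∃ (p : Prog) (c d : ℕ), ∀ I : ZInput K m,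
    (∀ ω, HaltsWithin p (I.load 0) ω
      (c * ((I.size : ℝ) + 1) ^ d) (c * ((I.size : ℝ) + 1) ^ d)) ∧
    3 / 4 ≤ coinLaw (outputBetween p (I.load 0)
      (I.value : ℝ) (ρ I.order * (I.value : ℝ)))

/-! ### Bit sizes of rational numbers -/

/-! `normConst` is multiplicative over block diagonal sums: a set of indices of `t` copies of `A`
splits into `t` independent sets of indices, and the minors factor, so the value of the power is `Z
^ t` (`normConst_blockPow`). Both classes are closed under block diagonal powers, and `1 ≤ Z` since
the empty set contributes 1 and no term is negative.

Suppose that some δ < 1 admits a `2^(n^δ)`-approximation `p`. Applied to `t` copies it yields `Z ^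
t` up to a factor `2^((tn)^δ)`, hence `Z` up to `2^((tn)^δ / t)` after a `t`-th root. As δ < 1, a
polynomially large `t` brings the exponent below `1/N` (`rpow_order_le`). The root is found only on
the grid of powers of `1 + 1/N`, which costs one more factor `e^(1/N)`; with `2/N ≤ ε` the total
error is at most `e^ε` (`root_approx`). Thus a subexponential approximation yields an FPRAS
(`hasFPRAS_of_hasApprox`), which is the claimed dichotomy.

The rest is machine work: `rootProg` builds the power, runs a copy of `p` on banks of its own and
searches for the root. Time and bit sizes must be polynomial for all coin flips, also those for
which the output of `p` is wrong (`exec_rootProg`, `le_pow_of_ratSize`). -/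

theorem clog_two_mul_le (x y : ℕ) : Nat.clog 2 (x * y) ≤ Nat.clog 2 x + Nat.clog 2 y := by
  apply Nat.clog_le_of_le_pow
  rw [pow_add]
  exact Nat.mul_le_mul (Nat.le_pow_clog one_lt_two x) (Nat.le_pow_clog one_lt_two y)

theorem clog_two_two : Nat.clog 2 2 = 1 :=
  le_antisymm (Nat.clog_le_of_le_pow (by norm_num)) (Nat.clog_pos one_lt_two one_lt_two)

theorem two_le_ratSize (x : ℚ) : 2 ≤ ratSize x := by
  have : Nat.clog 2 2 ≤ Nat.clog 2 (x.den + 1) := Nat.clog_mono_right 2 (by have := x.den_pos; omega)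
  have h2 := clog_two_two
  unfold ratSize; omega

/-- Cancelling common factors only shrinks numerator and denominator. The bounds for products,
inverses and sums come from this by writing the result as an unreduced fraction. -/
theorem ratSize_le_of_eq_div {x : ℚ} {a : ℤ} {b : ℕ} (hb : b ≠ 0) (h : x = a / b) :
    ratSize x ≤ 1 + Nat.clog 2 (a.natAbs + 1) + Nat.clog 2 (b + 1) := by
  have hx : x = Rat.divInt a b := by rw [h, Rat.divInt_eq_div]; simp
  have h1 : x.num.natAbs ≤ a.natAbs := by
    by_cases ha : a = 0
    · subst ha; simp [h]
    · have := Rat.num_dvd a (b := (b : ℤ)) (by exact_mod_cast hb)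
      rw [← hx] at this
      exact Nat.le_of_dvd (Int.natAbs_pos.2 ha) (Int.natAbs_dvd_natAbs.2 this)
  have h2 : x.den ≤ b := by
    have := Rat.den_dvd a (b : ℤ)
    rw [← hx] at this
    exact Nat.le_of_dvd (Nat.pos_of_ne_zero hb) (by exact_mod_cast this)
  unfold ratSize
  have := Nat.clog_mono_right 2 (Nat.add_le_add_right h1 1)
  have := Nat.clog_mono_right 2 (Nat.add_le_add_right h2 1)
  omega

theorem ratSize_mul_le (x y : ℚ) : ratSize (x * y) ≤ ratSize x + ratSize y := by
  have h := ratSize_le_of_eq_div (x := x * y) (a := x.num * y.num) (b := x.den * y.den)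
    (by simp) (by push_cast; rw [← div_mul_div_comm, Rat.num_div_den, Rat.num_div_den])
  have h1 : Nat.clog 2 ((x.num * y.num).natAbs + 1) ≤
      Nat.clog 2 (x.num.natAbs + 1) + Nat.clog 2 (y.num.natAbs + 1) :=
    (Nat.clog_mono_right 2 (by
      rw [Int.natAbs_mul, add_mul, mul_add]; omega)).trans (clog_two_mul_le _ _)
  have h2 : Nat.clog 2 (x.den * y.den + 1) ≤
      Nat.clog 2 (x.den + 1) + Nat.clog 2 (y.den + 1) :=
    (Nat.clog_mono_right 2 (by rw [add_mul, mul_add]; omega)).trans (clog_two_mul_le _ _)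
  unfold ratSize at *; omega

theorem ratSize_inv_le (x : ℚ) : ratSize x⁻¹ ≤ ratSize x := by
  by_cases hx : x = 0
  · simp [hx]
  · have hn : x.num ≠ 0 := Rat.num_ne_zero.2 hx
    have h := ratSize_le_of_eq_div (x := x⁻¹) (a := x.num.sign * x.den) (b := x.num.natAbs)
      (by simpa using hn) (by
        conv_lhs => rw [← Rat.num_div_den x]
        have hs : (x.num.natAbs : ℚ) = x.num.sign * x.num := by
          rw [← Int.cast_mul, Int.sign_mul_self_eq_natAbs, Int.cast_natCast]
        have hs0 : (x.num.sign : ℚ) ≠ 0 := by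
          have : x.num.sign ≠ 0 := by simpa using hx
          exact_mod_cast this
        rw [hs, inv_div]; push_cast
        rw [mul_div_mul_left _ _ hs0])
    have e : (x.num.sign * (x.den : ℤ)).natAbs = x.den := by
      rw [Int.natAbs_mul, Int.natAbs_sign_of_ne_zero hn]; simp
    rw [e] at h
    unfold ratSize at *; omega

theorem ratSize_neg (x : ℚ) : ratSize (-x) = ratSize x := by
  simp [ratSize]

theorem ratSize_div_le (x y : ℚ) : ratSize (x / y) ≤ ratSize x + ratSize y := by
  rw [div_eq_mul_inv]
  exact (ratSize_mul_le _ _).trans (Nat.add_le_add_left (ratSize_inv_le y) _)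

/-- The factor 2 arises because the denominators enter twice, in the common denominator and in the
cross terms of the numerator. -/
theorem ratSize_add_le (x y : ℚ) : ratSize (x + y) ≤ 2 * (ratSize x + ratSize y) := by
  have h := ratSize_le_of_eq_div (x := x + y) (a := x.num * y.den + x.den * y.num)
    (b := x.den * y.den)
    (by simp) (by
      push_cast
      rw [← div_add_div _ _ (by simp) (by simp), Rat.num_div_den, Rat.num_div_den])
  have h1 : Nat.clog 2 ((x.num * y.den + x.den * y.num).natAbs + 1) ≤
      (Nat.clog 2 (x.num.natAbs + 1) + Nat.clog 2 (y.num.natAbs + 1)) +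
      (Nat.clog 2 (x.den + 1) + Nat.clog 2 (y.den + 1)) := by
    refine le_trans (Nat.clog_mono_right 2 ?_) ((clog_two_mul_le _ _).trans
      (Nat.add_le_add (clog_two_mul_le _ _) (clog_two_mul_le _ _)))
    have := Int.natAbs_add_le (x.num * y.den) (x.den * y.num)
    simp only [Int.natAbs_mul, Int.natAbs_natCast] at this
    have hx := x.den_pos
    have hy := y.den_pos
    generalize x.num.natAbs = a at *
    generalize y.num.natAbs = b at *
    generalize x.den = c at *
    generalize y.den = d at *
    have e : (a + 1) * (b + 1) * ((c + 1) * (d + 1)) =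
      a * d + c * b + 1 + (a*b*c*d + a*b*c + a*b*d + a*b + a*c*d + a * c + a
        + b*c*d + b*d + b + c*d + c + d) := by ring
    omega
  have h2 : Nat.clog 2 (x.den * y.den + 1) ≤
      Nat.clog 2 (x.den + 1) + Nat.clog 2 (y.den + 1) :=
    (Nat.clog_mono_right 2 (by rw [add_mul, mul_add]; omega)).trans (clog_two_mul_le _ _)
  unfold ratSize at *; omega

theorem ratSize_sub_le (x y : ℚ) : ratSize (x - y) ≤ 2 * (ratSize x + ratSize y) := by
  rw [sub_eq_add_neg, ← ratSize_neg y]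
  exact ratSize_add_le _ _

theorem ratSize_intCast (z : ℤ) : ratSize z = 2 + Nat.clog 2 (z.natAbs + 1) := by
  simp [ratSize, clog_two_two]; omega

theorem ratSize_floor_le (x : ℚ) : ratSize (⌊x⌋ : ℚ) ≤ ratSize x := by
  rw [ratSize_intCast]
  have h1 : Nat.clog 2 2 ≤ Nat.clog 2 (x.den + 1) :=
    Nat.clog_mono_right 2 (by have := x.den_pos; omega)
  have h2 := clog_two_two
  have h3 : ⌊x⌋.natAbs ≤ x.num.natAbs := by
    change (Rat.floor x).natAbs ≤ _
    rw [Rat.floor_def]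
    exact Int.natAbs_ediv_le_natAbs _ _
  have := Nat.clog_mono_right 2 (Nat.add_le_add_right h3 1)
  unfold ratSize; omega

/-- Linear instead of logarithmic, which suffices: the naturals to which it is applied are
themselves polynomially bounded. -/
theorem ratSize_natCast_le (k : ℕ) : ratSize k ≤ k + 2 := by
  have := ratSize_intCast k
  have h : Nat.clog 2 (k + 1) ≤ k := Nat.clog_le_of_le_pow Nat.lt_two_pow_self
  simp at this
  omega

theorem ratSize_pow_le (x : ℚ) (k : ℕ) : ratSize (x ^ k) ≤ (k + 2) * ratSize x := by
  induction k with
  -- The number 1 has size 3, which may exceed the size of `x` (at least 2); this is why the factor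
  -- is `k + 2`.
  | zero =>
    have h1 := ratSize_natCast_le 1
    have := two_le_ratSize x
    simp at h1 ⊢; omega
  | succ k ih =>
    rw [pow_succ]
    have := ratSize_mul_le (x ^ k) x
    nlinarith

theorem le_two_pow_ratSize (x : ℚ) : x ≤ 2 ^ ratSize x := by
  have h1 : x ≤ x.num.natAbs := by
    by_cases hx : 0 ≤ x
    · conv_lhs => rw [← Rat.num_div_den x]
      have h0 : (x.num : ℚ) = x.num.natAbs := by
        have := Rat.num_nonneg.2 hx
        rw [← Int.cast_natCast, Int.natAbs_of_nonneg this]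
      rw [h0]
      exact div_le_self (by positivity) (by exact_mod_cast x.den_pos)
    · exact (not_le.1 hx).le.trans (by positivity)
  have h2 : x.num.natAbs ≤ 2 ^ ratSize x := by
    have := Nat.le_pow_clog one_lt_two (x.num.natAbs + 1)
    have h3 : 2 ^ Nat.clog 2 (x.num.natAbs + 1) ≤ 2 ^ ratSize x :=
      Nat.pow_le_pow_right (by norm_num) (by unfold ratSize; omega)
    omega
  exact h1.trans (by exact_mod_cast h2)

/-! ### Bit bounds for expressions -/

/-- Every number in the memory has at most `R` bits. -/
def Memory.Bounded (R : ℕ) (M : Memory) : Prop := ∀ a k, ratSize (M a k) ≤ R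

theorem Memory.Bounded.two_le {R : ℕ} {M : Memory} (h : M.Bounded R) : 2 ≤ R :=
  (two_le_ratSize _).trans (h 0 0)

theorem Memory.Bounded.mono {R R' : ℕ} {M : Memory} (h : M.Bounded R) (hR : R ≤ R') :
    M.Bounded R' := fun a k => (h a k).trans hR

theorem Memory.Bounded.write {R : ℕ} {M : Memory} (h : M.Bounded R) (a k : ℕ) {x : ℚ}
    (hx : ratSize x ≤ R) : (M.write a k x).Bounded R := by
  intro a' k'
  unfold Memory.write
  split_ifs
  · exact hx
  · exact h _ _

theorem Expr.ratSize_eval_le_bits (M : Memory) (e : Expr) : ratSize (e.eval M) ≤ e.bits M := by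
  cases e <;> simp [Expr.bits, Expr.eval]

/-- Each operation enlarges sizes by at most a constant factor, and the expression is fixed, so the
constant is independent of the memory. -/
theorem Expr.bits_le (e : Expr) :
    ∃ c : ℕ, ∀ (M : Memory) (R : ℕ), M.Bounded R → e.bits M ≤ c * R := by
  induction e with
  | const q =>
    exact ⟨ratSize q, fun M R h => Nat.le_mul_of_pos_right _ (by have := h.two_le; omega)⟩
  | read a i ih =>
    obtain ⟨c, hc⟩ := ih
    refine ⟨c + 1, fun M R h => max_le ?_ ?_⟩
    · have := hc M R h; nlinarith
    · have := h a ⌊i.eval M⌋₊; simp only [Expr.eval]; nlinarith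
  | add e f ihe ihf =>
    obtain ⟨c, hc⟩ := ihe
    obtain ⟨d, hd⟩ := ihf
    refine ⟨2 * (c + d), fun M R h => ?_⟩
    have h1 := hc M R h
    have h2 := hd M R h
    have h3 := e.ratSize_eval_le_bits M
    have h4 := f.ratSize_eval_le_bits M
    have h5 := ratSize_add_le (e.eval M) (f.eval M)
    have : 2 * (c + d) * R = 2 * (c * R) + 2 * (d * R) := by ring
    simp only [Expr.bits, Expr.eval]
    omega
  | sub e f ihe ihf =>
    obtain ⟨c, hc⟩ := ihe
    obtain ⟨d, hd⟩ := ihf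
    refine ⟨2 * (c + d), fun M R h => ?_⟩
    have h1 := hc M R h
    have h2 := hd M R h
    have h3 := e.ratSize_eval_le_bits M
    have h4 := f.ratSize_eval_le_bits M
    have h5 := ratSize_sub_le (e.eval M) (f.eval M)
    have : 2 * (c + d) * R = 2 * (c * R) + 2 * (d * R) := by ring
    simp only [Expr.bits, Expr.eval]
    omega
  | mul e f ihe ihf =>
    obtain ⟨c, hc⟩ := ihe
    obtain ⟨d, hd⟩ := ihf
    refine ⟨c + d, fun M R h => ?_⟩
    have h1 := hc M R h
    have h2 := hd M R h
    have h3 := e.ratSize_eval_le_bits M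
    have h4 := f.ratSize_eval_le_bits M
    have h5 := ratSize_mul_le (e.eval M) (f.eval M)
    have : (c + d) * R = c * R + d * R := by ring
    simp only [Expr.bits, Expr.eval]
    omega
  | div e f ihe ihf =>
    obtain ⟨c, hc⟩ := ihe
    obtain ⟨d, hd⟩ := ihf
    refine ⟨c + d, fun M R h => ?_⟩
    have h1 := hc M R h
    have h2 := hd M R h
    have h3 := e.ratSize_eval_le_bits M
    have h4 := f.ratSize_eval_le_bits M
    have h5 := ratSize_div_le (e.eval M) (f.eval M)
    have : (c + d) * R = c * R + d * R := by ring
    simp only [Expr.bits, Expr.eval]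
    omega
  | floor e ih =>
    obtain ⟨c, hc⟩ := ih
    refine ⟨c, fun M R h => ?_⟩
    have h1 := hc M R h
    have h3 := e.ratSize_eval_le_bits M
    have h5 := ratSize_floor_le (e.eval M)
    simp only [Expr.bits, Expr.eval]
    omega

/-! ### Straight-line programs and loops over them -/

/-- An assignment: a bank, an address and a value. -/
abbrev Assignment := ℕ × Expr × Expr

/-- The program that carries out a list of assignments. -/
def Prog.block : List Assignment → Prog
  | [] => .skip
  | (a, i, e) :: l => .seq (.assign a i e) (Prog.block l)

/-- The effect of a list of assignments on the memory. -/
def Memory.run : List Assignment → Memory → Memory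
  | [], M => M
  | (a, i, e) :: l, M => Memory.run l (M.write a ⌊i.eval M⌋₊ (e.eval M))

theorem Memory.run_append (l l' : List Assignment) (M : Memory) :
    M.run (l ++ l') = (M.run l).run l' := by
  induction l generalizing M with
  | nil => rfl
  | cons x l ih => exact ih _

theorem Prog.exec_block (l : List Assignment) :
    ∃ c : ℕ, ∀ (M : Memory) (ω : ℕ → Bool) (R : ℕ), M.Bounded R →
      (M.run l).Bounded (c * R) ∧
      ∃ t b, t ≤ c ∧ b ≤ c * R ∧ Exec (.block l) ⟨M, ω⟩ t b ⟨M.run l, ω⟩ := by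
  induction l with
  | nil =>
    refine ⟨1, fun M ω R h => ⟨by simpa [Memory.run] using h, 1, 0, le_rfl, by simp, Exec.skip _⟩⟩
  | cons x l ih =>
    obtain ⟨a, i, e⟩ := x
    obtain ⟨c, hc⟩ := ih
    obtain ⟨ci, hi⟩ := i.bits_le
    obtain ⟨ce, he⟩ := e.bits_le
    refine ⟨c * (ce + 1) + ci + ce + i.cost + e.cost + 1 + c, fun M ω R h => ?_⟩
    have h1 := hi M R h
    have h2 := he M R h
    have hb : (M.write a ⌊i.eval M⌋₊ (e.eval M)).Bounded ((ce + 1) * R) := by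
      refine (h.mono (by nlinarith)).write _ _ ?_
      have := e.ratSize_eval_le_bits M
      nlinarith
    obtain ⟨h3, t, b, ht, hb, hx⟩ := hc _ ω _ hb
    have h4 : c * ((ce + 1) * R) + ci * R + ce * R ≤
        (c * (ce + 1) + ci + ce + i.cost + e.cost + 1 + c) * R := by
      have : (c * (ce + 1) + ci + ce + i.cost + e.cost + 1 + c) * R =
        c * ((ce + 1) * R) + ci * R + ce * R + (i.cost + e.cost + 1 + c) * R := by ring
      omega
    refine ⟨h3.mono (by omega), _, _, ?_, ?_, Exec.seq (Exec.assign a i e ⟨M, ω⟩) hx⟩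
    · omega
    · simp only; omega

/-- Iterating the bound of `Prog.exec_block` would give a factor exponential in `K`. Therefore `R`
is required to bound all iterates in advance; it is verified later from closed forms of the
iterates. -/
theorem Prog.exec_while_block (e f : Expr) (l : List Assignment) :
    ∃ c : ℕ, ∀ (K R : ℕ) (M : Memory) (ω : ℕ → Bool),
      (∀ j < K, e.eval ((Memory.run l)^[j] M) < f.eval ((Memory.run l)^[j] M)) →
      ¬ e.eval ((Memory.run l)^[K] M) < f.eval ((Memory.run l)^[K] M) →
      (∀ j ≤ K, ((Memory.run l)^[j] M).Bounded R) →
      ∃ t b, t ≤ c * (K + 1) ∧ b ≤ c * R ∧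
        Exec (.while e f (.block l)) ⟨M, ω⟩ t b ⟨(Memory.run l)^[K] M, ω⟩ := by
  obtain ⟨c, hc⟩ := Prog.exec_block l
  obtain ⟨ce, he⟩ := e.bits_le
  obtain ⟨cf, hf⟩ := f.bits_le
  refine ⟨c + ce + cf + e.cost + f.cost + 1, fun K => ?_⟩
  induction K with
  | zero =>
    intro R M ω _ h1 h2
    have h3 := he M R (h2 0 le_rfl)
    have h4 := hf M R (h2 0 le_rfl)
    have : (c + ce + cf + e.cost + f.cost + 1) * R =
      ce * R + cf * R + (c + e.cost + f.cost + 1) * R := by ring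
    exact ⟨_, _, by omega, by simp only; omega, Exec.whileFalse h1⟩
  | succ K ih =>
    intro R M ω h0 h1 h2
    have h3 := he M R (h2 0 (Nat.zero_le _))
    have h4 := hf M R (h2 0 (Nat.zero_le _))
    obtain ⟨-, t, b, ht, hb, hx⟩ := hc M ω R (h2 0 (Nat.zero_le _))
    obtain ⟨t', b', ht', hb', hx'⟩ := ih R (M.run l) ω
      (fun j hj => h0 (j + 1) (by omega)) h1 (fun j hj => h2 (j + 1) (by omega))
    have : (c + ce + cf + e.cost + f.cost + 1) * R =
      c * R + ce * R + cf * R + (e.cost + f.cost + 1) * R := by ring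
    refine ⟨_, _, ?_, ?_, Exec.whileTrue (h0 0 (by omega)) hx hx'⟩
    · rw [mul_add _ (K + 1)]; omega
    · simp only; omega

/-- An execution leaves a cell with its old content or with a number that was handled. -/
theorem Exec.ratSize_mem_le {p : Prog} {s s' : MState} {t b : ℕ} (h : Exec p s t b s') (a k : ℕ) :
    ratSize (s'.mem a k) ≤ max (ratSize (s.mem a k)) b := by
  induction h with
  | skip s => simp
  | assign a' i e s =>
    have := e.ratSize_eval_le_bits s.mem
    simp only [Memory.write]
    split_ifs <;> omega
  | flip a' i s =>
    have h0 : ratSize 0 = 2 := by simp [ratSize, clog_two_two]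
    have := two_le_ratSize 1
    simp only [Memory.write]
    split_ifs <;> omega
  | seq _ _ ih1 ih2 => omega
  | iteTrue _ _ ih => omega
  | iteFalse _ _ ih => omega
  | whileTrue _ _ _ ih1 ih2 => omega
  | whileFalse _ => simp

/-! ### Shifting the banks of a program -/

/-- Rename bank `a` to `a + C` throughout an expression. -/
def Expr.shift (C : ℕ) : Expr → Expr
  | const q => const q
  | read a i => read (a + C) (i.shift C)
  | add e f => add (e.shift C) (f.shift C)
  | sub e f => sub (e.shift C) (f.shift C)
  | mul e f => mul (e.shift C) (f.shift C)
  | div e f => div (e.shift C) (f.shift C)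
  | floor e => floor (e.shift C)

/-- Rename bank `a` to `a + C` throughout a program. -/
def Prog.shift (C : ℕ) : Prog → Prog
  | skip => skip
  | assign a i e => assign (a + C) (i.shift C) (e.shift C)
  | flip a i => flip (a + C) (i.shift C)
  | seq p q => seq (p.shift C) (q.shift C)
  | ite e f p q => ite (e.shift C) (f.shift C) (p.shift C) (q.shift C)
  | .while e f p => .while (e.shift C) (f.shift C) (p.shift C)

/-- Merge two memories: the banks below `C` come from `N`, the others from `M`. -/
def Memory.above (C : ℕ) (N M : Memory) : Memory :=
  fun a k => if a < C then N a k else M (a - C) k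

theorem Memory.above_add (C : ℕ) (N M : Memory) (a k : ℕ) :
    Memory.above C N M (a + C) k = M a k := by
  simp [Memory.above]

theorem Memory.write_above (C : ℕ) (N M : Memory) (a k : ℕ) (x : ℚ) :
    (Memory.above C N M).write (a + C) k x = Memory.above C N (M.write a k x) := by
  funext a' k'
  simp only [Memory.write, Memory.above]
  by_cases h : a' < C
  · have : a' ≠ a + C := by omega
    simp [h, this]
  · have : a' = a + C ↔ a' - C = a := by omega
    simp [h, this]

theorem Expr.cost_shift (C : ℕ) (e : Expr) : (e.shift C).cost = e.cost := by
  induction e <;> simp_all [Expr.shift, Expr.cost]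

theorem Expr.eval_shift (C : ℕ) (N M : Memory) (e : Expr) :
    (e.shift C).eval (Memory.above C N M) = e.eval M := by
  induction e <;> simp_all [Expr.shift, Expr.eval, Memory.above_add]

theorem Expr.bits_shift (C : ℕ) (N M : Memory) (e : Expr) :
    (e.shift C).bits (Memory.above C N M) = e.bits M := by
  induction e <;>
    simp_all [Expr.shift, Expr.bits, Expr.eval, Memory.above_add, Expr.eval_shift]

/-- The shifted program imitates `p` step by step with the same time, bits and coins, and leaves the
banks below `C` intact. This lets a larger program call `p` and keep its own parameters. -/
theorem Exec.shift {p : Prog} {s s' : MState} {t b : ℕ} (h : Exec p s t b s') (C : ℕ)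
    (N : Memory) : Exec (p.shift C) ⟨Memory.above C N s.mem, s.coins⟩ t b
      ⟨Memory.above C N s'.mem, s'.coins⟩ := by
  induction h with
  | skip s => exact Exec.skip _
  | assign a i e s =>
    have := Exec.assign (a + C) (i.shift C) (e.shift C) ⟨Memory.above C N s.mem, s.coins⟩
    simpa only [Prog.shift, Expr.cost_shift, Expr.bits_shift, Expr.eval_shift, Memory.write_above] using this
  | flip a i s =>
    have := Exec.flip (a + C) (i.shift C) ⟨Memory.above C N s.mem, s.coins⟩
    simpa only [Prog.shift, Expr.cost_shift, Expr.bits_shift, Expr.eval_shift, Memory.write_above] using this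
  | seq _ _ ih1 ih2 => exact Exec.seq ih1 ih2
  | @iteTrue e f p q s s' t b h _ ih =>
    have := Exec.iteTrue (e := e.shift C) (f := f.shift C) (q := q.shift C)
      (by simpa only [Expr.eval_shift] using h) ih
    simpa only [Prog.shift, Expr.cost_shift, Expr.bits_shift] using this
  | @iteFalse e f p q s s' t b h _ ih =>
    have := Exec.iteFalse (e := e.shift C) (f := f.shift C) (p := p.shift C)
      (by simpa only [Expr.eval_shift] using h) ih
    simpa only [Prog.shift, Expr.cost_shift, Expr.bits_shift] using this
  | @whileTrue e f p s s₁ s₂ t₁ t₂ b₁ b₂ h _ _ ih1 ih2 =>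
    have := Exec.whileTrue (e := e.shift C) (f := f.shift C)
      (by simpa only [Expr.eval_shift] using h) ih1 ih2
    simpa only [Prog.shift, Expr.cost_shift, Expr.bits_shift] using this
  | @whileFalse e f p s h =>
    have := Exec.whileFalse (e := e.shift C) (f := f.shift C) (p := p.shift C)
      (s := ⟨Memory.above C N s.mem, s.coins⟩)
      (by simpa only [Expr.eval_shift] using h)
    simpa only [Prog.shift, Expr.cost_shift, Expr.bits_shift] using this

/-! ### Block diagonal powers -/

/-- The block diagonal matrix with `t` copies of `A` on the diagonal. -/
def blockPow {n : ℕ} (t : ℕ) (A : Matrix (Fin n) (Fin n) ℚ) :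
    Matrix (Fin (t * n)) (Fin (t * n)) ℚ :=
  fun q r => if q.divNat = r.divNat then A q.modNat r.modNat else 0

/-- The `k`-th of the `t` parts of a set of indices of a block diagonal power. -/
def blockPart {n t : ℕ} (S : Finset (Fin (t * n))) (k : Fin t) : Finset (Fin n) :=
  Finset.univ.filter fun j => finProdFinEquiv (k, j) ∈ S

/-- A principal submatrix of a block diagonal matrix is block diagonal with respect to the block
number, so its determinant is the product over the blocks. -/
theorem det_blockPow_submatrix {n t : ℕ} (A : Matrix (Fin n) (Fin n) ℚ)
    (S : Finset (Fin (t * n))) :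
    ((blockPow t A).submatrix (Subtype.val : S → Fin (t * n)) Subtype.val).det =
      ∏ k, (A.submatrix (Subtype.val : blockPart S k → Fin n) Subtype.val).det := by
  have hT : ((blockPow t A).submatrix (Subtype.val : S → Fin (t * n))
      Subtype.val).BlockTriangular (fun x : S => x.1.divNat) := by
    intro i j hij
    simp only [Matrix.submatrix_apply, blockPow]
    rw [if_neg (ne_of_gt hij)]
  rw [hT.det_fintype]
  refine Finset.prod_congr rfl fun k _ => ?_
  have hq : ∀ (q : Fin (t * n)) (k : Fin t), q.divNat = k →
      finProdFinEquiv (k, q.modNat) = q := by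
    rintro q _ rfl
    exact finProdFinEquiv.apply_symm_apply q
  let e : {x : S // x.1.divNat = k} ≃ blockPart S k :=
    { toFun := fun x => ⟨x.1.1.modNat, by
        have h : finProdFinEquiv (k, x.1.1.modNat) = x.1.1 := by
          exact hq _ _ x.2
        simp [blockPart, h]⟩
      invFun := fun j => ⟨⟨finProdFinEquiv (k, j.1), by simpa [blockPart] using j.2⟩, by
        exact congrArg Prod.fst (finProdFinEquiv.symm_apply_apply (k, j.1))⟩
      left_inv := fun x => by
        apply Subtype.ext; apply Subtype.ext
        simp only
        exact hq _ _ x.2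
      right_inv := fun j => by
        apply Subtype.ext
        exact congrArg Prod.snd (finProdFinEquiv.symm_apply_apply (k, j.1)) }
  rw [← Matrix.det_submatrix_equiv_self e]
  congr 1
  ext i j
  simp only [Matrix.toSquareBlock_def, Matrix.of_apply, Matrix.submatrix_apply, blockPow, e,
    Equiv.coe_fn_mk]
  rw [if_pos (i.2.trans j.2.symm)]

/-- Sets of indices of a block diagonal power correspond to families of sets of indices. -/
def blockPartEquiv (n t : ℕ) : Finset (Fin (t * n)) ≃ (Fin t → Finset (Fin n)) where
  toFun := blockPart
  invFun f := Finset.univ.filter fun q => q.modNat ∈ f q.divNat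
  left_inv S := by
    ext q
    have h : finProdFinEquiv (q.divNat, q.modNat) = q := finProdFinEquiv.apply_symm_apply q
    simp [blockPart, h]
  right_inv f := by
    funext k
    ext j
    have h1 : (finProdFinEquiv (k, j)).divNat = k :=
      congrArg Prod.fst (finProdFinEquiv.symm_apply_apply (k, j))
    have h2 : (finProdFinEquiv (k, j)).modNat = j :=
      congrArg Prod.snd (finProdFinEquiv.symm_apply_apply (k, j))
    simp [blockPart, h1, h2]

/-- Expanding the `t`-th power of the sum gives a sum over families of `t` sets, which
`blockPartEquiv` identifies with the sets of indices of the power. -/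
theorem normConst_blockPow {m n : ℕ} (t : ℕ) (A : Fin m → Matrix (Fin n) (Fin n) ℚ) :
    normConst (fun i => blockPow t (A i)) = normConst A ^ t := by
  unfold normConst
  rw [← Finset.card_fin t, ← Finset.prod_const, Finset.prod_univ_sum, Finset.card_fin,
    Fintype.piFinset_univ]
  refine Fintype.sum_equiv (blockPartEquiv n t) _ _ fun S => ?_
  simp only [det_blockPow_submatrix]
  rw [Finset.prod_comm]
  rfl

/-! ### The two matrix classes and positivity of the normalizing constant -/

theorem pZeroClass_of_psdClass {n : ℕ} {A : Matrix (Fin n) (Fin n) ℚ} (h : psdClass n A) :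
    pZeroClass n A := by
  intro S
  have h1 := (Matrix.PosSemidef.submatrix h (Subtype.val : S → Fin n)).det_nonneg
  have h2 : ((A.map (Rat.cast : ℚ → ℝ)).submatrix (Subtype.val : S → Fin n) Subtype.val).det =
      (((A.submatrix (Subtype.val : S → Fin n) Subtype.val).det : ℚ) : ℝ) := by
    have := (Rat.castHom ℝ).map_det (A.submatrix (Subtype.val : S → Fin n) Subtype.val)
    exact this.symm
  rw [h2] at h1
  exact_mod_cast h1

theorem pZeroClass_blockPow {n : ℕ} {A : Matrix (Fin n) (Fin n) ℚ} (t : ℕ)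
    (h : pZeroClass n A) : pZeroClass (t * n) (blockPow t A) := by
  intro S
  rw [det_blockPow_submatrix]
  exact Finset.prod_nonneg fun k _ => h _

/-- Up to reindexing, the power is the Kronecker product of an identity matrix with `A`. -/
theorem psdClass_blockPow {n : ℕ} {A : Matrix (Fin n) (Fin n) ℚ} (t : ℕ)
    (h : psdClass n A) : psdClass (t * n) (blockPow t A) := by
  have h1 : ((1 : Matrix (Fin t) (Fin t) ℝ).kronecker (A.map (Rat.cast : ℚ → ℝ))).PosSemidef :=
    Matrix.PosSemidef.one.kronecker h
  have h2 := h1.submatrix (finProdFinEquiv (m := t) (n := n)).symm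
  unfold psdClass
  convert h2 using 1
  ext q r
  have e1 : ∀ q : Fin (t * n), finProdFinEquiv.symm q = (q.divNat, q.modNat) := fun _ => rfl
  simp only [Matrix.map_apply, blockPow, Matrix.submatrix_apply, e1, Matrix.kronecker,
    Matrix.kroneckerMap_apply, Matrix.one_apply]
  split_ifs <;> simp

theorem one_le_normConst {m n : ℕ} {A : Fin m → Matrix (Fin n) (Fin n) ℚ}
    (h : ∀ i, pZeroClass n (A i)) : 1 ≤ normConst A := by
  unfold normConst
  have h1 : (1 : ℚ) = ∏ i, ((A i).submatrix
      (Subtype.val : (∅ : Finset (Fin n)) → Fin n) Subtype.val).det := by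
    symm
    exact Finset.prod_eq_one fun i _ => Matrix.det_isEmpty
  rw [h1]
  exact Finset.single_le_sum (f := fun S : Finset (Fin n) => ∏ i, ((A i).submatrix
    (Subtype.val : S → Fin n) Subtype.val).det)
    (fun S _ => Finset.prod_nonneg fun i _ => h i S) (Finset.mem_univ ∅)

/-! ### The input for the block diagonal power -/

/-- The input whose matrices are the block diagonal powers of the matrices of `I`. -/
def ZInput.power {K : MatrixClass} {m : ℕ} (I : ZInput K m) (t : ℕ)
    (hK : ∀ i, K (t * I.order) (blockPow t (I.mat i))) : ZInput K m where
  order := t * I.order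
  mat i := blockPow t (I.mat i)
  mem_class := hK

/-- An address, in a matrix of order `n` stored row by row, for the entry that cell `q` of its
block diagonal power of order `D` holds; the address is at least `n * n` outside the blocks. -/
def blockAddr (n D q : ℕ) : ℕ :=
  q / D % n * n + q % D % n + (q / D / n - q % D / n + (q % D / n - q / D / n)) ^ 2 * (n * n)

theorem blockAddr_le (n D q : ℕ) : blockAddr n D q ≤ q * q * (n * n) + q * n + q := by
  unfold blockAddr
  have h1 : q / D % n ≤ q := (Nat.mod_le _ _).trans (Nat.div_le_self _ _)
  have h2 : q % D % n ≤ q := (Nat.mod_le _ _).trans (Nat.mod_le _ _)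
  have h3 : q / D / n ≤ q := (Nat.div_le_self _ _).trans (Nat.div_le_self _ _)
  have h4 : q % D / n ≤ q := (Nat.div_le_self _ _).trans (Nat.mod_le _ _)
  have h5 : q / D / n - q % D / n + (q % D / n - q / D / n) ≤ q := by
    generalize q / D / n = x at *
    generalize q % D / n = y at *
    omega
  have h6 := Nat.mul_le_mul_right (n * n) (Nat.pow_le_pow_left h5 2)
  have h7 := Nat.mul_le_mul_right n h1
  rw [sq q] at h6
  omega

theorem ZInput.load_succ {K : MatrixClass} {m : ℕ} (I : ZInput K m) (ε : ℚ) (a k : ℕ) :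
    I.load ε (a + 1) k = if h : a < m ∧ k < I.order * I.order then
      I.mat ⟨a, h.1⟩ ⟨k / I.order, Nat.div_lt_of_lt_mul h.2⟩
        ⟨k % I.order, Nat.mod_lt _ (Nat.pos_of_mul_pos_left (Nat.zero_lt_of_lt h.2))⟩
    else 0 := rfl

/-- Copying needs no test for membership in a block: off the blocks `blockAddr` points past the `n *
n` stored entries, where the loaded memory is 0. -/
theorem ZInput.load_power {K : MatrixClass} {m : ℕ} (I : ZInput K m) (t : ℕ)
    (hK : ∀ i, K (t * I.order) (blockPow t (I.mat i))) (ε : ℚ) {a q : ℕ}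
    (ha : a < m) (hq : q < t * I.order * (t * I.order)) :
    (I.power t hK).load 0 (a + 1) q =
      I.load ε (a + 1) (blockAddr I.order (t * I.order) q) := by
  have hn : 0 < I.order := by
    rcases Nat.eq_zero_or_pos I.order with h | h
    · simp [h] at hq
    · exact h
  rw [ZInput.load_succ, dif_pos ⟨ha, hq⟩, ZInput.load_succ]
  simp only [ZInput.power, blockPow]
  have h1 : q / (t * I.order) % I.order < I.order := Nat.mod_lt _ hn
  have h2 : q % (t * I.order) % I.order < I.order := Nat.mod_lt _ hn
  by_cases h : q / (t * I.order) / I.order = q % (t * I.order) / I.order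
  · have hadd : blockAddr I.order (t * I.order) q =
        q / (t * I.order) % I.order * I.order + q % (t * I.order) % I.order := by
      unfold blockAddr
      rw [h]; simp
    rw [if_pos (Fin.ext h), dif_pos ⟨ha, by rw [hadd]; nlinarith⟩]
    congr 1 <;> apply Fin.ext
    · simp only [Fin.modNat]
      rw [hadd, add_comm, Nat.add_mul_div_right _ _ hn, Nat.div_eq_of_lt h2, zero_add]
    · simp only [Fin.modNat]
      rw [hadd, add_comm, Nat.add_mul_mod_self_right, Nat.mod_eq_of_lt h2]
  · rw [if_neg (fun h' => h (congrArg Fin.val h')), dif_neg]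
    rintro ⟨-, h'⟩
    have h3 : 1 ≤ q / (t * I.order) / I.order - q % (t * I.order) / I.order +
        (q % (t * I.order) / I.order - q / (t * I.order) / I.order) := by omega
    have h4 := Nat.mul_le_mul_right (I.order * I.order) (Nat.pow_le_pow_left h3 2)
    unfold blockAddr at h'
    omega

/-! ### The program -/

/-- The content of cell `k` of bank `0`. -/
def Expr.cell (k : ℕ) : Expr := .read 0 (.const k)

/-- A power of an expression with a fixed exponent. -/
def Expr.npow (e : Expr) : ℕ → Expr
  | 0 => .const 1
  | k + 1 => .mul (e.npow k) e

theorem Expr.eval_cell (M : Memory) (k : ℕ) : (Expr.cell k).eval M = M 0 k := by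
  simp [Expr.eval, Expr.cell]

theorem Expr.eval_npow (M : Memory) (e : Expr) (k : ℕ) : (e.npow k).eval M = e.eval M ^ k := by
  induction k with
  | zero => simp [Expr.npow, Expr.eval]
  | succ k ih => simp [Expr.npow, Expr.eval, ih, pow_succ]

/-- The parameters, kept in bank `0`: `N` in cell `2`, the number `t` of blocks in cell `3`,
the order of the power in cell `4`, the base `1 + 1/N` in cell `7`, and its powers in cells `8`,
`10` and `11`. Bank `m + 1` is the bank `0` of the shifted program. -/
def initList (m K : ℕ) : List Assignment :=
  [(0, .const (2 : ℕ), .mul (.const 2) (.add (.floor (.div (.const 1) (.cell 1))) (.const 1))),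
   (0, .const (3 : ℕ), (Expr.mul (.add (.cell 0) (.const 1)) (.cell 2)).npow K),
   (0, .const (4 : ℕ), .mul (.cell 3) (.cell 0)),
   (0, .const (7 : ℕ), .add (.const 1) (.div (.const 1) (.cell 2))),
   (0, .const (8 : ℕ), .const 1),
   (0, .const (10 : ℕ), .const 1),
   (0, .const (11 : ℕ), .const 1),
   (m + 1, .const (0 : ℕ), .cell 4)]

/-- The expression for `blockAddr`. -/
def addrExpr : Expr :=
  let r := Expr.floor (.div (.cell 5) (.cell 4))
  let c := Expr.sub (.cell 5) (.mul r (.cell 4))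
  let r' := Expr.floor (.div r (.cell 0))
  let c' := Expr.floor (.div c (.cell 0))
  .add (.add (.mul (.sub r (.mul r' (.cell 0))) (.cell 0)) (.sub c (.mul c' (.cell 0))))
    (.mul (.mul (.sub r' c') (.sub r' c')) (.mul (.cell 0) (.cell 0)))

/-- Copy one entry into each of `j` matrices. -/
def copyList (m j : ℕ) : List Assignment :=
  (List.range j).map fun a => (a + 1 + (m + 1), .cell 5, .read (a + 1) (.cell 6))

/-- One step of the loop that writes the block diagonal powers. -/
def fillList (m : ℕ) : List Assignment :=
  (0, .const (6 : ℕ), addrExpr) ::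
    (copyList m m ++ [(0, .const (5 : ℕ), .add (.cell 5) (.const 1))])

/-- One step of the loop that computes `(1 + 1/N)^t`. -/
def powList : List Assignment :=
  [(0, .const (8 : ℕ), .mul (.cell 8) (.cell 7)), (0, .const (9 : ℕ), .add (.cell 9) (.const 1))]

/-- One step of the loop that searches for the root. -/
def rootList : List Assignment :=
  [(0, .const (10 : ℕ), .mul (.cell 10) (.cell 8)),
   (0, .const (11 : ℕ), .mul (.cell 11) (.cell 7))]

/-- Run `p` on the block diagonal power of the input and take the root of the output. -/
def rootProg (m K : ℕ) (p : Prog) : Prog :=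
  .seq (.block (initList m K)) <|
  .seq (.while (.cell 5) (.mul (.cell 4) (.cell 4)) (.block (fillList m))) <|
  .seq (.while (.cell 9) (.cell 3) (.block powList)) <|
  .seq (p.shift (m + 1)) <|
  .seq (.while (.cell 10) (.read (m + 1) (.const (0 : ℕ))) (.block rootList)) <|
  .block [(0, .const (0 : ℕ), .cell 11)]

/-! ### The effect of the loops -/

/-- Of the two truncated differences in `blockAddr` one vanishes and the other is the distance of
the block numbers, so the square of their sum is the square of the rational difference. -/
theorem eval_addrExpr {M : Memory} {n D q : ℕ} (h0 : M 0 0 = n) (h4 : M 0 4 = D)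
    (h5 : M 0 5 = q) : addrExpr.eval M = blockAddr n D q := by
  have hf : ∀ a b : ℕ, (⌊(a : ℚ) / b⌋ : ℚ) = ((a / b : ℕ) : ℚ) := fun a b => by
    rw [Rat.floor_natCast_div_natCast]; norm_cast
  have hm : ∀ a b : ℕ, (a : ℚ) - ((a / b : ℕ) : ℚ) * b = ((a % b : ℕ) : ℚ) := fun a b => by
    have : ((a % b + b * (a / b) : ℕ) : ℚ) = a := by rw [Nat.mod_add_div]
    push_cast at this ⊢
    linarith
  simp only [addrExpr, Expr.eval, Expr.eval_cell, h0, h4, h5, hf, hm]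
  unfold blockAddr
  generalize q / D / n = x
  generalize q % D / n = y
  rcases le_total x y with h | h
  · obtain ⟨z, rfl⟩ := Nat.exists_eq_add_of_le h
    simp only [Nat.sub_eq_zero_of_le h, Nat.add_sub_cancel_left]
    push_cast; ring
  · obtain ⟨z, rfl⟩ := Nat.exists_eq_add_of_le h
    simp only [Nat.sub_eq_zero_of_le h, Nat.add_sub_cancel_left]
    push_cast; ring

/-- The sources are banks at most `m` and the targets are banks above `m + 1`, so no copy disturbs a
later one or the cells 5 and 6 of bank 0. -/
theorem run_copyList (m j : ℕ) (hj : j ≤ m) (M : Memory) :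
    M.run (copyList m j) = fun a k =>
      if m + 1 < a ∧ a ≤ m + 1 + j ∧ k = ⌊M 0 5⌋₊ then M (a - (m + 1)) ⌊M 0 6⌋₊ else M a k := by
  induction j with
  | zero =>
    funext a k
    rw [if_neg (by omega)]
    rfl
  | succ j ih =>
    have : copyList m (j + 1) = copyList m j ++
      [(j + 1 + (m + 1), .cell 5, .read (j + 1) (.cell 6))] := by
      simp [copyList, List.range_succ]
    rw [this, Memory.run_append, ih (by omega)]
    funext a k
    simp only [Memory.run, Memory.write, Expr.eval, Expr.eval_cell]
    have e1 : ¬ (m + 1 < 0) := by omega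
    have e2 : ¬ (m + 1 < j + 1) := by omega
    simp only [e1, e2, false_and, if_false]
    by_cases h1 : a = j + 1 + (m + 1)
    · subst h1
      have e3 : j + 1 + (m + 1) - (m + 1) = j + 1 := by omega
      have e4 : ¬ (j + 1 + (m + 1) ≤ m + 1 + j) := by omega
      have e5 : m + 1 < j + 1 + (m + 1) := by omega
      have e6 : j + 1 + (m + 1) ≤ m + 1 + (j + 1) := by omega
      simp only [e3, e4, e5, e6, true_and, false_and, and_false, if_false]
    · have e7 : a ≤ m + 1 + (j + 1) ↔ a ≤ m + 1 + j := by omega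
      simp only [h1, e7, false_and, if_false]

/-- The memory after `j` steps of the loop over `fillList`. -/
def fillMem (m n D : ℕ) (M : Memory) (j : ℕ) : Memory := fun a k =>
  if a = 0 then
    if k = 5 then j
    else if k = 6 then if j = 0 then M 0 6 else blockAddr n D (j - 1)
    else M 0 k
  else if m + 1 < a ∧ a ≤ m + 1 + m ∧ k < j then M (a - (m + 1)) (blockAddr n D k)
  else M a k

theorem iterate_run_fillList {m n D : ℕ} {M : Memory} (h0 : M 0 0 = n) (h4 : M 0 4 = D)
    (h5 : M 0 5 = 0) (j : ℕ) : (Memory.run (fillList m))^[j] M = fillMem m n D M j := by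
  induction j with
  | zero =>
    funext a k
    simp only [Function.iterate_zero, id, fillMem]
    split_ifs <;> simp_all
  | succ j ih =>
    rw [Function.iterate_succ_apply', ih]
    have ha := eval_addrExpr (M := fillMem m n D M j) (n := n) (D := D) (q := j)
      (by simpa [fillMem] using h0) (by simpa [fillMem] using h4) (by simp [fillMem])
    simp only [fillList, Memory.run, Memory.run_append, run_copyList m m le_rfl, ha]
    funext a k
    simp only [Memory.write, Expr.eval, Expr.eval_cell]
    by_cases h1 : a = 0
    · subst h1
      simp only [fillMem]
      by_cases h2 : k = 5 <;> by_cases h3 : k = 6 <;> simp [h2, h3]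
    · have e1 : fillMem m n D M j 0 5 = j := by simp [fillMem]
      simp only [h1, fillMem, false_and, if_false, if_true]
      simp
      by_cases h2 : m + 1 < a ∧ a ≤ m + 1 + m
      · have h3 : ¬ (m + 1 < a - (m + 1)) := by omega
        have h4 : a - (m + 1) ≠ 0 := by omega
        by_cases h6 : k = j
        · subst h6
          simp [h2.1, h2.2, h3, h4]
        · have h7 : k ≤ j ↔ k < j := by omega
          simp [h6, h7]
      · have h3 : ∀ P : Prop, ¬ (m + 1 < a ∧ a ≤ m + 1 + m ∧ P) := fun P h => h2 ⟨h.1, h.2.1⟩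
        simp [h3]

theorem iterate_run_powList (M : Memory) (j : ℕ) :
    (Memory.run powList)^[j] M =
      (M.write 0 8 (M 0 8 * M 0 7 ^ j)).write 0 9 (M 0 9 + j) := by
  induction j with
  | zero =>
    funext a k
    simp only [Memory.write, Function.iterate_zero, id]
    split_ifs with h1 h2
    · simp [h1.1, h1.2]
    · simp [h2.1, h2.2]
    · rfl
  | succ j ih =>
    rw [Function.iterate_succ_apply', ih]
    funext a k
    simp only [powList, Memory.run, Memory.write, Expr.eval, Expr.eval_cell]
    by_cases h1 : a = 0 <;> by_cases h2 : k = 8 <;> by_cases h3 : k = 9 <;>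
      simp [h1, h2, h3, pow_succ, mul_assoc, add_assoc]

theorem iterate_run_rootList (M : Memory) (j : ℕ) :
    (Memory.run rootList)^[j] M =
      (M.write 0 10 (M 0 10 * M 0 8 ^ j)).write 0 11 (M 0 11 * M 0 7 ^ j) := by
  induction j with
  | zero =>
    funext a k
    simp only [Memory.write, Function.iterate_zero, id]
    split_ifs with h1 h2
    · simp [h1.1, h1.2]
    · simp [h2.1, h2.2]
    · rfl
  | succ j ih =>
    rw [Function.iterate_succ_apply', ih]
    funext a k
    simp only [rootList, Memory.run, Memory.write, Expr.eval, Expr.eval_cell]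
    by_cases h1 : a = 0 <;> by_cases h2 : k = 10 <;> by_cases h3 : k = 11 <;>
      simp [h1, h2, h3, pow_succ, mul_assoc]

/-! ### The execution of the program -/

/-- Cells 5 and 9 of bank 0 are the loop counters; they are never initialized and rely on being 0 in
the loaded memory. -/
theorem run_initList (m K n N : ℕ) (ε : ℚ) (M : Memory) (h0 : M 0 0 = n) (h1 : M 0 1 = ε)
    (hN : (N : ℚ) = 2 * (⌊1 / ε⌋ + 1)) (hz : ∀ k, M 0 (k + 2) = 0) :
    M.run (initList m K) 0 0 = n ∧
    M.run (initList m K) 0 3 = ((((n + 1) * N) ^ K : ℕ) : ℚ) ∧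
    M.run (initList m K) 0 4 = ((((n + 1) * N) ^ K * n : ℕ) : ℚ) ∧
    M.run (initList m K) 0 5 = 0 ∧
    M.run (initList m K) 0 7 = 1 + 1 / N ∧
    M.run (initList m K) 0 8 = 1 ∧
    M.run (initList m K) 0 9 = 0 ∧
    M.run (initList m K) 0 10 = 1 ∧
    M.run (initList m K) 0 11 = 1 ∧
    ∀ a k, a ≠ 0 → M.run (initList m K) a k =
      if a = m + 1 ∧ k = 0 then ((((n + 1) * N) ^ K * n : ℕ) : ℚ) else M a k := by
  have h5 := hz 3
  have h9 := hz 7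
  have hc : ∀ (M : Memory) (q : ℚ), (Expr.const q).eval M = q := fun _ _ => rfl
  refine ⟨?_, ?_, ?_, ?_, ?_, ?_, ?_, ?_, ?_, ?_⟩
  all_goals
    simp only [initList, Memory.run, Memory.write, Expr.eval_npow, Expr.eval, Expr.eval_cell,
      h0, h1, Nat.floor_natCast]
  · simp
  · simp [hN]
  · simp [hN]
  · simpa using h5
  · simp [hN]
  · simp
  · simpa using h9
  · simp
  · simp
  · intro a k ha
    simp [ha, hN]

/-- After the copying loop, the banks from `m + 1` on look exactly like a freshly loaded power, so
an execution of `p` on that input can be shifted there. Lower banks are unconstrained, so `M'`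
itself supplies them. -/
theorem ZInput.above_load_power {κ : MatrixClass} {m : ℕ} (I : ZInput κ m) (t : ℕ)
    (hK : ∀ i, κ (t * I.order) (blockPow t (I.mat i))) (ε : ℚ) {M : Memory}
    (h : ∀ a k, a ≠ 0 → M a k =
      if a = m + 1 ∧ k = 0 then ((t * I.order : ℕ) : ℚ) else I.load ε a k) {M' : Memory}
    (h' : ∀ a k, a ≠ 0 → M' a k =
      fillMem m I.order (t * I.order) M (t * I.order * (t * I.order)) a k) :
    M' = Memory.above (m + 1) M' ((I.power t hK).load 0) := by
  funext a k
  unfold Memory.above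
  split_ifs with ha
  · rfl
  obtain ⟨a, rfl⟩ := Nat.exists_eq_add_of_le (not_lt.1 ha)
  rw [h' _ _ (by omega), fillMem, if_neg (by omega), Nat.add_sub_cancel_left]
  have hload : ∀ b k, m ≤ b → I.load ε (b + 1) k = 0 := fun b k hb => by
    rw [ZInput.load_succ, dif_neg (by omega)]
  rcases a with _ | a
  · rw [if_neg (by omega), h _ _ (by omega)]
    rcases k with _ | _ | k
    · simp [ZInput.load, ZInput.power]
    · rw [if_neg (by omega), add_zero, hload _ _ le_rfl]; rfl
    · rw [if_neg (by omega), add_zero, hload _ _ le_rfl]; rfl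
  · by_cases hm : a < m
    · by_cases hk : k < t * I.order * (t * I.order)
      · rw [if_pos (by omega), h _ _ (by omega), if_neg (by omega),
          ZInput.load_power I t hK ε hm hk]
      · rw [if_neg (by omega), h _ _ (by omega), if_neg (by omega), ZInput.load_succ (I.power t hK),
          dif_neg (fun h => hk h.2), ← add_assoc, hload _ _ (by omega)]
    · rw [if_neg (by omega), h _ _ (by omega), if_neg (by omega), ZInput.load_succ (I.power t hK),
          dif_neg (fun h => hm h.1), ← add_assoc, hload _ _ (by omega)]

theorem fillMem_bounded {m n D R : ℕ} {M : Memory} (hM : M.Bounded R) {j : ℕ}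
    (hj : j ≤ D * D) (hR : D * D * (D * D) * (n * n) + D * D * n + D * D + 2 ≤ R) :
    (fillMem m n D M j).Bounded R := by
  intro a k
  unfold fillMem
  have hmono : ∀ q ≤ D * D, ratSize (blockAddr n D q) ≤ R := fun q hq => by
    refine (ratSize_natCast_le _).trans (le_trans (Nat.add_le_add_right (blockAddr_le n D q) 2) ?_)
    have h1 := Nat.mul_le_mul_right (n * n) (Nat.mul_le_mul hq hq)
    have h2 := Nat.mul_le_mul_right n hq
    omega
  split_ifs
  · exact (ratSize_natCast_le j).trans (by omega)
  · exact hM _ _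
  · exact hmono _ (by omega)
  · exact hM _ _
  · exact hM _ _
  · exact hM _ _

theorem ratSize_one_add_inv_le (N : ℕ) : ratSize (1 + 1 / (N : ℚ)) ≤ 2 * N + 16 := by
  have h1 := ratSize_add_le 1 (1 / (N : ℚ))
  have h2 := ratSize_div_le 1 (N : ℚ)
  have h3 := ratSize_natCast_le N
  have h4 := ratSize_natCast_le 1
  norm_num at h4
  omega

/-- The last two hypotheses say that `k` is the number of rounds of the root search. The bounds
assumed for `R` cover the addresses used in copying and the powers of `1 + 1/N` in the two other
loops. -/
theorem exec_rootProg (κ : MatrixClass) (m K : ℕ) (p : Prog) :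
    ∃ c : ℕ, ∀ (I : ZInput κ m) (ε : ℚ) (N t D R k : ℕ) (ω : ℕ → Bool)
      (hK : ∀ i, κ (t * I.order) (blockPow t (I.mat i))) (t₀ b₀ : ℕ) (s₀ : MState),
      (N : ℚ) = 2 * (⌊1 / ε⌋ + 1) → t = ((I.order + 1) * N) ^ K → D = t * I.order →
      Exec p ⟨(I.power t hK).load 0, ω⟩ t₀ b₀ s₀ →
      (I.load ε).Bounded R → b₀ ≤ R →
      D * D * (D * D) * (I.order * I.order) + D * D * I.order + D * D + 2 ≤ R →
      (t * k + t + k + 2) * (2 * N + 16) ≤ R →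
      (∀ j < k, ((1 + 1 / (N : ℚ)) ^ t) ^ j < s₀.mem 0 0) →
      s₀.mem 0 0 ≤ ((1 + 1 / (N : ℚ)) ^ t) ^ k →
      ∃ t₁ b₁ s₁, Exec (rootProg m K p) ⟨I.load ε, ω⟩ t₁ b₁ s₁ ∧
        t₁ ≤ c * (D * D + t + k + 1) + t₀ ∧ b₁ ≤ c * R ∧ s₁.mem 0 0 = (1 + 1 / (N : ℚ)) ^ k := by
  obtain ⟨c1, hc1⟩ := Prog.exec_block (initList m K)
  obtain ⟨c2, hc2⟩ := Prog.exec_while_block (.cell 5) (.mul (.cell 4) (.cell 4)) (fillList m)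
  obtain ⟨c3, hc3⟩ := Prog.exec_while_block (.cell 9) (.cell 3) powList
  obtain ⟨c4, hc4⟩ := Prog.exec_while_block (.cell 10) (.read (m + 1) (.const (0 : ℕ))) rootList
  obtain ⟨c5, hc5⟩ := Prog.exec_block [(0, .const (0 : ℕ), .cell 11)]
  -- The first block raises the bound on the memory from `R` to at most `(c1 + 1) * R`, which then
  -- serves all stages; the summand 1 accounts for `p`.
  refine ⟨(c1 + c2 + c3 + c4 + c5 + 1) * (c1 + 1), ?_⟩
  intro I ε N t D R k ω hK t₀ b₀ s₀ hN ht hD hp hR hb hR1 hR2 hk1 hk2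
  obtain ⟨hM1, t1, b1, ht1, hb1, hx1⟩ := hc1 _ ω _ hR
  obtain ⟨i0, i3, i4, i5, i7, i8, i9, i10, i11, ia⟩ :=
    run_initList m K I.order N ε (I.load ε) rfl rfl hN (fun _ => rfl)
  rw [← ht] at i3
  rw [← ht, ← hD] at i4
  rw [← ht] at ia
  generalize (I.load ε).run (initList m K) = M1 at *
  set R' := (c1 + 1) * R with hR'
  have hRR : R ≤ R' := by rw [hR']; nlinarith
  replace hM1 : M1.Bounded R' := hM1.mono (by rw [hR']; nlinarith)
  have hDD : D ≤ D * D := Nat.le_mul_self D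
  -- the first loop
  have hit2 := iterate_run_fillList (m := m) i0 i4 i5
  obtain ⟨t2, b2, ht2, hb2, hx2⟩ := hc2 (D * D) R' M1 ω
    (fun j hj => by
      rw [hit2]
      simp only [Expr.eval, Expr.eval_cell, fillMem]
      simp [i4]; exact_mod_cast hj)
    (by
      rw [hit2]
      simp only [Expr.eval, Expr.eval_cell, fillMem]
      simp [i4])
    (fun j hj => by
      rw [hit2]
      exact fillMem_bounded hM1 hj (hR1.trans hRR))
  have hM2 : ((Memory.run (fillList m))^[D * D] M1).Bounded R' := by
    rw [hit2]
    exact fillMem_bounded hM1 le_rfl (hR1.trans hRR)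
  have j0 : ∀ k, k ≠ 5 → k ≠ 6 → (Memory.run (fillList m))^[D * D] M1 0 k = M1 0 k := by
    intro k h5 h6
    rw [hit2]; simp [fillMem, h5, h6]
  have ja : ∀ a k, a ≠ 0 → (Memory.run (fillList m))^[D * D] M1 a k =
      fillMem m I.order D M1 (D * D) a k := by
    intro a k _
    rw [hit2]
  generalize (Memory.run (fillList m))^[D * D] M1 = M2 at *
  -- the second loop
  have hpow : ∀ j, j ≤ t * k + t + k → ratSize ((1 + 1 / (N : ℚ)) ^ j) ≤ R' := fun j hj => by
    refine (ratSize_pow_le _ _).trans (le_trans (Nat.mul_le_mul ?_ (ratSize_one_add_inv_le N))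
      (hR2.trans hRR))
    omega
  have hit3 := iterate_run_powList M2
  have hb3 : ∀ j ≤ t, ((Memory.run powList)^[j] M2).Bounded R' := fun j hj => by
    rw [hit3, j0 8 (by decide) (by decide), j0 7 (by decide) (by decide),
      j0 9 (by decide) (by decide), i8, i7, i9, one_mul, zero_add]
    refine (hM2.write _ _ (hpow j (by omega))).write _ _ ((ratSize_natCast_le _).trans ?_)
    have := (Nat.le_mul_of_pos_right (t * k + t + k + 2) (by omega : 0 < 2 * N + 16)).trans
      (hR2.trans hRR)
    omega
  obtain ⟨t3, b3, ht3, hb3', hx3⟩ := hc3 t R' M2 ω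
    (fun j hj => by
      rw [hit3]
      simp only [Expr.eval_cell, Memory.write]
      simpa [j0, i9, i3] using hj)
    (by
      rw [hit3]
      simp only [Expr.eval_cell, Memory.write]
      simp [j0, i9, i3])
    hb3
  have hM3 := hb3 t le_rfl
  have k0 : ∀ k, k ≠ 5 → k ≠ 6 → k ≠ 8 → k ≠ 9 → (Memory.run powList)^[t] M2 0 k = M1 0 k := by
    intro k h5 h6 h8 h9
    rw [hit3]; simp [Memory.write, h8, h9, j0 k h5 h6]
  have k8 : (Memory.run powList)^[t] M2 0 8 = (1 + 1 / (N : ℚ)) ^ t := by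
    rw [hit3]; simp [Memory.write, j0, i8, i7]
  have ka : (Memory.run powList)^[t] M2 =
      Memory.above (m + 1) ((Memory.run powList)^[t] M2) ((I.power t hK).load 0) := by
    refine I.above_load_power t hK ε ia fun a k ha => ?_
    rw [hit3, ← hD]; simp [Memory.write, ha, ja a k ha]
  generalize (Memory.run powList)^[t] M2 = M3 at *
  -- the shifted program
  have hx4 := hp.shift (m + 1) M3
  simp only at hx4
  rw [← ka] at hx4
  -- A cell now holds either its content from before `p` or a number that `p` handled.
  have hM4 : (Memory.above (m + 1) M3 s₀.mem).Bounded R' := fun a k =>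
    (hx4.ratSize_mem_le a k).trans (max_le (hM3 a k) (hb.trans hRR))
  have l0 : ∀ k, Memory.above (m + 1) M3 s₀.mem 0 k = M3 0 k := fun k => by simp [Memory.above]
  have lC : Memory.above (m + 1) M3 s₀.mem (m + 1) 0 = s₀.mem 0 0 := by simp [Memory.above]
  generalize Memory.above (m + 1) M3 s₀.mem = M4 at *
  -- the third loop
  have hit5 := iterate_run_rootList M4
  have n10 : M4 0 10 = 1 := by
    rw [l0, k0 10 (by decide) (by decide) (by decide) (by decide), i10]
  have n11 : M4 0 11 = 1 := by
    rw [l0, k0 11 (by decide) (by decide) (by decide) (by decide), i11]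
  have n7 : M4 0 7 = 1 + 1 / (N : ℚ) := by
    rw [l0, k0 7 (by decide) (by decide) (by decide) (by decide), i7]
  have n8 : M4 0 8 = (1 + 1 / (N : ℚ)) ^ t := by rw [l0, k8]
  rw [n10, n11, n7, n8] at hit5
  simp only [one_mul] at hit5
  have hb5 : ∀ j ≤ k, ((Memory.run rootList)^[j] M4).Bounded R' := fun j hj => by
    rw [hit5]
    refine (hM4.write _ _ ?_).write _ _ (hpow j (by omega))
    rw [← pow_mul]
    exact hpow _ (by have := Nat.mul_le_mul_left t hj; omega)
  have g10 : ∀ j, (Expr.cell 10).eval ((Memory.run rootList)^[j] M4) =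
      ((1 + 1 / (N : ℚ)) ^ t) ^ j := fun j => by
    rw [hit5, Expr.eval_cell]; simp [Memory.write]
  have gC : ∀ j, (Expr.read (m + 1) (.const (0 : ℕ))).eval ((Memory.run rootList)^[j] M4) =
      s₀.mem 0 0 := fun j => by
    rw [hit5]; simp [Expr.eval, Memory.write, lC]
  obtain ⟨t5, b5, ht5, hb5', hx5⟩ := hc4 k R' M4 s₀.coins
    (fun j hj => by rw [g10, gC]; exact hk1 j hj)
    (by rw [g10, gC]; exact not_lt.2 hk2)
    hb5
  have hM5 := hb5 k le_rfl
  have o11 : (Memory.run rootList)^[k] M4 0 11 = (1 + 1 / (N : ℚ)) ^ k := by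
    rw [hit5]; simp [Memory.write]
  generalize (Memory.run rootList)^[k] M4 = M5 at *
  obtain ⟨-, t6, b6, ht6, hb6, hx6⟩ := hc5 M5 s₀.coins R' hM5
  refine ⟨_, _, _, Exec.seq hx1 (Exec.seq hx2 (Exec.seq hx3 (Exec.seq hx4
    (Exec.seq hx5 hx6)))), ?_, ?_, ?_⟩
  · have hS : 1 ≤ D * D + t + k + 1 := by omega
    have e1 : t1 ≤ c1 * (D * D + t + k + 1) := ht1.trans (Nat.le_mul_of_pos_right _ hS)
    have e2 : t2 ≤ c2 * (D * D + t + k + 1) := ht2.trans (Nat.mul_le_mul_left _ (by omega))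
    have e3 : t3 ≤ c3 * (D * D + t + k + 1) := ht3.trans (Nat.mul_le_mul_left _ (by omega))
    have e5 : t5 ≤ c4 * (D * D + t + k + 1) := ht5.trans (Nat.mul_le_mul_left _ (by omega))
    have e6 : t6 ≤ c5 * (D * D + t + k + 1) := ht6.trans (Nat.le_mul_of_pos_right _ hS)
    have e7 : (c1 + c2 + c3 + c4 + c5) * (D * D + t + k + 1) ≤
        (c1 + c2 + c3 + c4 + c5 + 1) * (c1 + 1) * (D * D + t + k + 1) :=
      Nat.mul_le_mul_right _ ((Nat.le_succ _).trans (Nat.le_mul_of_pos_right _ (Nat.succ_pos _)))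
    have e8 : (c1 + c2 + c3 + c4 + c5) * (D * D + t + k + 1) =
      c1 * (D * D + t + k + 1) + c2 * (D * D + t + k + 1) + c3 * (D * D + t + k + 1) +
        c4 * (D * D + t + k + 1) + c5 * (D * D + t + k + 1) := by ring
    omega
  · have e : (c1 + c2 + c3 + c4 + c5 + 1) * (c1 + 1) * R =
      c1 * R' + c2 * R' + c3 * R' + c4 * R' + c5 * R' + R' := by rw [hR']; ring
    have e1 : c1 * R ≤ c1 * R' := Nat.mul_le_mul_left _ hRR
    rw [e]
    simp only [max_le_iff]
    refine ⟨?_, ?_, ?_, ?_, ?_, ?_⟩ <;> omega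
  · simp only [Memory.run, Memory.write, Expr.eval_cell]
    simp [Expr.eval, o11]

/-! ### The root of an approximation -/

/-- Since `K * (1 - δ) ≥ 1`, `t^(1-δ)` is at least `(n + 1) * N`, hence at least `n^δ * N`; multiply
by `t^δ`. Using `n + 1` keeps `t` positive when `n = 0`. -/
theorem rpow_order_le {δ : ℝ} (hδ0 : 0 < δ) (hδ1 : δ < 1) {K : ℕ} (hK : (1 - δ)⁻¹ ≤ K)
    {n N t : ℕ} (hN : 1 ≤ N) (ht : t = ((n + 1) * N) ^ K) :
    (N : ℝ) * ((t * n : ℕ) : ℝ) ^ δ ≤ t := by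
  have hQ : (1 : ℝ) ≤ ((n + 1) * N : ℕ) := by exact_mod_cast Nat.mul_pos (Nat.succ_pos n) hN
  have ht' : (t : ℝ) = (((n + 1) * N : ℕ) : ℝ) ^ (K : ℝ) := by
    rw [ht, Real.rpow_natCast]; push_cast; rfl
  have ht1 : (1 : ℝ) ≤ t := by rw [ht']; exact Real.one_le_rpow hQ (Nat.cast_nonneg K)
  have h1 : ((n : ℝ)) ^ δ ≤ n + 1 :=
    calc ((n : ℝ)) ^ δ ≤ ((n : ℝ) + 1) ^ δ :=
          Real.rpow_le_rpow (Nat.cast_nonneg n) (by linarith) hδ0.le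
      _ ≤ ((n : ℝ) + 1) ^ (1 : ℝ) := Real.rpow_le_rpow_of_exponent_le
          (by have : (0 : ℝ) ≤ n := Nat.cast_nonneg n
              linarith) hδ1.le
      _ = n + 1 := Real.rpow_one _
  have h2 : ((n : ℝ) + 1) * N ≤ (t : ℝ) ^ (1 - δ) := by
    rw [ht', ← Real.rpow_mul (by positivity)]
    have : (1 : ℝ) ≤ K * (1 - δ) := by
      have hd : 0 < 1 - δ := by linarith
      calc (1 : ℝ) = (1 - δ)⁻¹ * (1 - δ) := (inv_mul_cancel₀ hd.ne').symm
        _ ≤ K * (1 - δ) := mul_le_mul_of_nonneg_right hK hd.le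
    calc ((n : ℝ) + 1) * N = (((n + 1) * N : ℕ) : ℝ) ^ (1 : ℝ) := by push_cast; simp
      _ ≤ _ := Real.rpow_le_rpow_of_exponent_le hQ this
  have h3 : (t : ℝ) = (t : ℝ) ^ δ * (t : ℝ) ^ (1 - δ) := by
    rw [← Real.rpow_add (by linarith)]; simp
  have h4 : (0 : ℝ) ≤ (t : ℝ) ^ δ := by positivity
  push_cast
  rw [Real.mul_rpow (by positivity) (by positivity)]
  calc (N : ℝ) * ((t : ℝ) ^ δ * (n : ℝ) ^ δ) ≤ (N : ℝ) * ((t : ℝ) ^ δ * (n + 1)) := by gcongr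
    _ = (t : ℝ) ^ δ * ((n + 1) * N) := by ring
    _ ≤ (t : ℝ) ^ δ * (t : ℝ) ^ (1 - δ) := by gcongr
    _ = t := h3.symm

/-- Rounding up to the grid preserves the lower bound. Above, one factor `e^(1/N)` is the `t`-th
root of `2^x`, because `x / t ≤ 1/N` and `2 ≤ e`, and the other is the last grid step `1 + 1/N`. -/
theorem root_approx {N t k : ℕ} {ε x Z Y : ℝ} (hN : 1 ≤ N) (hε : 2 / N ≤ ε) (ht : 1 ≤ t)
    (hx : N * x ≤ t) (hZ : 1 ≤ Z) (hlow : Z ^ t ≤ Y) (hupp : Y ≤ 2 ^ x * Z ^ t)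
    (hk1 : ∀ j < k, ((1 + 1 / (N : ℝ)) ^ t) ^ j < Y) (hk2 : Y ≤ ((1 + 1 / (N : ℝ)) ^ t) ^ k) :
    Real.exp (-ε) * Z ≤ (1 + 1 / (N : ℝ)) ^ k ∧
      (1 + 1 / (N : ℝ)) ^ k ≤ Real.exp ε * Z := by
  have hN' : (0 : ℝ) < N := by exact_mod_cast hN
  have ht' : (0 : ℝ) < t := by exact_mod_cast ht
  have hε0 : 0 < ε := lt_of_lt_of_le (by positivity) hε
  have ht0 : t ≠ 0 := by omega
  set u : ℝ := 1 + 1 / (N : ℝ) with hu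
  have hu0 : 0 < u := by positivity
  constructor
  · have h1 : Z ≤ u ^ k := by
      refine (pow_le_pow_iff_left₀ (by linarith) (by positivity) ht0).1 ?_
      rw [← pow_mul, mul_comm k, pow_mul]
      exact hlow.trans hk2
    have h2 : Real.exp (-ε) ≤ 1 := Real.exp_le_one_iff.2 (by linarith)
    nlinarith
  · have he : 1 ≤ Real.exp ε := Real.one_le_exp hε0.le
    rcases k with _ | k
    -- With no preceding grid point, the upper bound comes from `1 ≤ Z`.
    · rw [pow_zero]; nlinarith
    · have h1 : u ^ k ≤ Real.exp (1 / N) * Z := by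
        refine (pow_le_pow_iff_left₀ (by positivity) (by positivity) ht0).1 ?_
        rw [← pow_mul, mul_comm k, pow_mul, mul_pow]
        refine (hk1 k (Nat.lt_succ_self k)).le.trans (hupp.trans ?_)
        refine mul_le_mul_of_nonneg_right ?_ (by positivity)
        have hx' : x ≤ t * (1 / N) := by
          rw [mul_one_div, le_div_iff₀ hN']; linarith
        have hx1 : (0 : ℝ) ≤ t * (1 / N) := by positivity
        rw [← Real.exp_nat_mul]
        calc (2 : ℝ) ^ x ≤ 2 ^ (t * (1 / N) : ℝ) :=
              Real.rpow_le_rpow_of_exponent_le (by norm_num) hx'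
          _ ≤ Real.exp 1 ^ (t * (1 / N) : ℝ) :=
              Real.rpow_le_rpow (by norm_num)
                (by have := Real.add_one_le_exp (1 : ℝ); linarith) hx1
          _ = Real.exp (t * (1 / N)) := by rw [← Real.exp_mul, one_mul]
      have h2 : u ≤ Real.exp (1 / N) := by
        have := Real.add_one_le_exp (1 / (N : ℝ)); linarith
      calc u ^ (k + 1) = u ^ k * u := pow_succ _ _
        _ ≤ Real.exp (1 / N) * Z * Real.exp (1 / N) :=
            mul_le_mul h1 h2 hu0.le (by positivity)
        _ = Real.exp (2 / N) * Z := by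
            rw [mul_right_comm, ← Real.exp_add, ← add_div]; norm_num
        _ ≤ Real.exp ε * Z := by gcongr

/-- By Bernoulli, `(1 + 1/N)^N ≥ 2`, so `N` grid steps gain at least one bit. This bounds the root
search for every output of `p`, correct or not. -/
theorem le_pow_of_ratSize {N t : ℕ} (hN : 1 ≤ N) (ht : 1 ≤ t) (y : ℚ) :
    y ≤ ((1 + 1 / (N : ℚ)) ^ t) ^ (N * ratSize y) := by
  have hN' : (0 : ℚ) < N := by exact_mod_cast hN
  have hu : (1 : ℚ) ≤ 1 + 1 / N := by
    have : (0 : ℚ) < 1 / N := by positivity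
    linarith
  have h2 : (2 : ℚ) ≤ (1 + 1 / N) ^ N := by
    have := one_add_mul_le_pow (a := 1 / (N : ℚ)) (by have : (0 : ℚ) < 1 / N := by positivity
                                                      linarith) N
    rw [mul_one_div_cancel hN'.ne'] at this
    linarith
  calc y ≤ 2 ^ ratSize y := le_two_pow_ratSize y
    _ ≤ ((1 + 1 / (N : ℚ)) ^ N) ^ ratSize y := pow_le_pow_left₀ (by norm_num) h2 _
    _ = (1 + 1 / (N : ℚ)) ^ (N * ratSize y) := (pow_mul _ _ _).symm
    _ ≤ ((1 + 1 / (N : ℚ)) ^ t) ^ (N * ratSize y) :=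
        pow_le_pow_left₀ (by linarith) (le_self_pow₀ hu (by omega)) _

/-! ### Sizes of inputs -/

theorem ratSize_entry_le {n : ℕ} (A : Matrix (Fin n) (Fin n) ℚ) (i j : Fin n) :
    ratSize (A i j) ≤ matSize A := by
  have h1 : ratSize (A i j) ≤ ∑ j, ratSize (A i j) :=
    Finset.single_le_sum (f := fun j => ratSize (A i j)) (fun _ _ => Nat.zero_le _)
      (Finset.mem_univ j)
  have h2 : ∑ j, ratSize (A i j) ≤ ∑ i, ∑ j, ratSize (A i j) :=
    Finset.single_le_sum (f := fun i => ∑ j, ratSize (A i j)) (fun _ _ => Nat.zero_le _)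
      (Finset.mem_univ i)
  unfold matSize
  omega

theorem ratSize_zero : ratSize 0 = 2 := by simp [ratSize, clog_two_two]

theorem matSize_blockPow_le {n : ℕ} (t : ℕ) (A : Matrix (Fin n) (Fin n) ℚ) :
    matSize (blockPow t A) ≤ t * n * (t * n) * (matSize A + 3) := by
  have h : ∀ i j, ratSize (blockPow t A i j) ≤ matSize A + 2 := fun i j => by
    unfold blockPow
    split_ifs
    · exact (ratSize_entry_le A _ _).trans (by omega)
    · rw [ratSize_zero]; omega
  have h1 : ∑ i, ∑ j, ratSize (blockPow t A i j) ≤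
      ∑ _i : Fin (t * n), ∑ _j : Fin (t * n), (matSize A + 2) :=
    Finset.sum_le_sum fun i _ => Finset.sum_le_sum fun j _ => h i j
  simp only [Finset.sum_const, Finset.card_univ, Fintype.card_fin, smul_eq_mul] at h1
  unfold matSize at h1 ⊢
  nlinarith

namespace ZInput

variable {κ : MatrixClass} {m : ℕ}

theorem matSize_le_size (I : ZInput κ m) (i : Fin m) : matSize (I.mat i) ≤ I.size :=
  Finset.single_le_sum (f := fun i => matSize (I.mat i)) (fun _ _ => Nat.zero_le _)
    (Finset.mem_univ i)

/-- For `m = 0` the size is 0 whatever the order, hence the positivity of `m`. -/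
theorem order_le_size (hm : 0 < m) (I : ZInput κ m) : I.order ≤ I.size := by
  refine le_trans ?_ (I.matSize_le_size ⟨0, hm⟩)
  unfold matSize
  have := Nat.le_mul_self I.order
  omega

theorem size_power_le (I : ZInput κ m) (t : ℕ)
    (hK : ∀ i, κ (t * I.order) (blockPow t (I.mat i))) :
    (I.power t hK).size ≤ m * (t * I.order * (t * I.order) * (I.size + 3)) := by
  have : (I.power t hK).size ≤ ∑ _i : Fin m, t * I.order * (t * I.order) * (I.size + 3) :=
    Finset.sum_le_sum fun i _ => (matSize_blockPow_le t (I.mat i)).trans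
      (Nat.mul_le_mul_left _ (Nat.add_le_add_right (I.matSize_le_size i) 3))
  simpa using this

theorem value_power (I : ZInput κ m) (t : ℕ)
    (hK : ∀ i, κ (t * I.order) (blockPow t (I.mat i))) :
    (I.power t hK).value = I.value ^ t := normConst_blockPow t I.mat

theorem load_bounded (I : ZInput κ m) (ε : ℚ) :
    (I.load ε).Bounded (I.size + ratSize ε + I.order + 2) := by
  intro a k
  rcases a with _ | a
  · rcases k with _ | _ | k
    · exact (ratSize_natCast_le I.order).trans (by omega)
    · change ratSize ε ≤ _; omega
    · change ratSize 0 ≤ _; rw [ratSize_zero]; omega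
  · rw [load_succ]
    split_ifs with h
    · exact (ratSize_entry_le _ _ _).trans ((I.matSize_le_size _).trans (by omega))
    · rw [ratSize_zero]; omega

end ZInput

/-! ### Polynomial bounds -/

/-- `f` is bounded by a polynomial in `X`. -/
def PolyBounded {ι : Type*} (X f : ι → ℕ) : Prop := ∃ c d : ℕ, ∀ i, f i ≤ c * (X i + 1) ^ d

namespace PolyBounded

variable {ι : Type*} {X f g : ι → ℕ}

theorem of_le (h : ∀ i, f i ≤ X i) : PolyBounded X f :=
  ⟨1, 1, fun i => by have := h i; simp only [pow_one]; omega⟩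

theorem const (X : ι → ℕ) (c : ℕ) : PolyBounded X fun _ => c := ⟨c, 0, fun i => by simp⟩

theorem add (hf : PolyBounded X f) (hg : PolyBounded X g) : PolyBounded X fun i => f i + g i := by
  obtain ⟨c, d, h⟩ := hf
  obtain ⟨c', d', h'⟩ := hg
  refine ⟨c + c', d + d', fun i => ?_⟩
  have h1 : (X i + 1) ^ d ≤ (X i + 1) ^ (d + d') := Nat.pow_le_pow_right (by omega) (by omega)
  have h2 : (X i + 1) ^ d' ≤ (X i + 1) ^ (d + d') := Nat.pow_le_pow_right (by omega) (by omega)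
  rw [add_mul]
  exact Nat.add_le_add ((h i).trans (Nat.mul_le_mul_left _ h1))
    ((h' i).trans (Nat.mul_le_mul_left _ h2))

theorem mul (hf : PolyBounded X f) (hg : PolyBounded X g) : PolyBounded X fun i => f i * g i := by
  obtain ⟨c, d, h⟩ := hf
  obtain ⟨c', d', h'⟩ := hg
  refine ⟨c * c', d + d', fun i => (Nat.mul_le_mul (h i) (h' i)).trans (le_of_eq ?_)⟩
  rw [pow_add]; ring

theorem pow (hf : PolyBounded X f) (K : ℕ) : PolyBounded X fun i => f i ^ K := by
  induction K with
  | zero => simpa using const X 1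
  | succ K ih => simpa only [pow_succ] using ih.mul hf

end PolyBounded

/-! ### From an approximation algorithm to an FPRAS -/

/-- Takes `k` to be the least exponent that reaches the output of `p`, and replaces it in the bounds
by an estimate that depends only on the bit bound `B` of `p`. -/
theorem exists_exec_rootProg (κ : MatrixClass) (m K : ℕ) (p : Prog) :
    ∃ c : ℕ, ∀ (I : ZInput κ m) (ε : ℚ) (N t D B : ℕ) (ω : ℕ → Bool)
      (hK : ∀ i, κ (t * I.order) (blockPow t (I.mat i))) (t₀ b₀ : ℕ) (s₀ : MState),
      (N : ℚ) = 2 * (⌊1 / ε⌋ + 1) → 1 ≤ N → t = ((I.order + 1) * N) ^ K → D = t * I.order →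
      Exec p ⟨(I.power t hK).load 0, ω⟩ t₀ b₀ s₀ → b₀ ≤ B →
      ∃ k t₁ b₁ s₁, Exec (rootProg m K p) ⟨I.load ε, ω⟩ t₁ b₁ s₁ ∧
        t₁ ≤ c * (D * D + t + N * (D + 2 + B) + 1) + t₀ ∧
        b₁ ≤ c * (I.size + ratSize ε + I.order + 2 + B +
          (D * D * (D * D) * (I.order * I.order) + D * D * I.order + D * D + 2) +
          (t * (N * (D + 2 + B)) + t + N * (D + 2 + B) + 2) * (2 * N + 16)) ∧
        s₁.mem 0 0 = (1 + 1 / (N : ℚ)) ^ k ∧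
        (∀ j < k, ((1 + 1 / (N : ℚ)) ^ t) ^ j < s₀.mem 0 0) ∧
        s₀.mem 0 0 ≤ ((1 + 1 / (N : ℚ)) ^ t) ^ k := by
  obtain ⟨c, hc⟩ := exec_rootProg κ m K p
  refine ⟨c, ?_⟩
  intro I ε N t D B ω hK t₀ b₀ s₀ hN hN1 ht hD hp hb
  have ht1 : 1 ≤ t := by
    rw [ht]; exact Nat.pow_pos (Nat.mul_pos (Nat.succ_pos _) hN1)
  have hex : ∃ k, s₀.mem 0 0 ≤ ((1 + 1 / (N : ℚ)) ^ t) ^ k := ⟨_, le_pow_of_ratSize hN1 ht1 _⟩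
  -- The term `D + 2` covers the case that `p` leaves its output cell untouched: that cell initially
  -- holds the order `D`.
  have hY : ratSize (s₀.mem 0 0) ≤ D + 2 + B := by
    refine (hp.ratSize_mem_le 0 0).trans (max_le ?_ (by omega))
    have := ratSize_natCast_le D
    change ratSize (((I.power t hK).order : ℕ) : ℚ) ≤ _
    change ratSize ((t * I.order : ℕ) : ℚ) ≤ _
    rw [← hD]; omega
  classical
  have hk : Nat.find hex ≤ N * (D + 2 + B) :=
    (Nat.find_min' hex (le_pow_of_ratSize hN1 ht1 _)).trans (Nat.mul_le_mul_left _ hY)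
  have hk1 : ∀ j < Nat.find hex, ((1 + 1 / (N : ℚ)) ^ t) ^ j < s₀.mem 0 0 :=
    fun j hj => not_le.1 (Nat.find_min hex hj)
  have hk2 := Nat.find_spec hex
  generalize Nat.find hex = k at *
  have hmono : (t * k + t + k + 2) * (2 * N + 16) ≤
      (t * (N * (D + 2 + B)) + t + N * (D + 2 + B) + 2) * (2 * N + 16) := by
    have := Nat.mul_le_mul_left t hk
    exact Nat.mul_le_mul_right _ (by omega)
  obtain ⟨t₁, b₁, s₁, h1, h2, h3, h4⟩ := hc I ε N t D (I.size + ratSize ε + I.order + 2 + B +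
          (D * D * (D * D) * (I.order * I.order) + D * D * I.order + D * D + 2) +
          (t * (N * (D + 2 + B)) + t + N * (D + 2 + B) + 2) * (2 * N + 16)) k ω hK t₀ b₀ s₀
    hN ht hD hp ((I.load_bounded ε).mono (by omega)) (by omega) (by omega) (by omega) hk1 hk2
  refine ⟨k, t₁, b₁, s₁, h1, h2.trans ?_, h3, h4, hk1, hk2⟩
  exact Nat.add_le_add_right (Nat.mul_le_mul_left _ (by omega)) _

/-- The factor 3 absorbs `N ≤ 2 * ε⁻¹ + 2`: then `size + N + 1` is at most three times `size + ε⁻¹ +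
1`. -/
theorem polyBounded_real {ι : Type*} {X f : ι → ℕ} (h : PolyBounded X f) :
    ∃ c d : ℕ, ∀ i (x : ℝ), (X i : ℝ) + 1 ≤ 3 * x → (f i : ℝ) ≤ c * x ^ d := by
  obtain ⟨c, d, h⟩ := h
  refine ⟨c * 3 ^ d, d, fun i x hx => ?_⟩
  calc (f i : ℝ) ≤ c * ((X i : ℝ) + 1) ^ d := by exact_mod_cast h i
    _ ≤ c * (3 * x) ^ d := by gcongr
    _ = ((c * 3 ^ d : ℕ) : ℝ) * x ^ d := by push_cast; rw [mul_pow]; ring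

/-- For a class of `P₀`-matrices that is closed under block diagonal powers, a subexponential
approximation can be turned into an FPRAS. -/
theorem hasFPRAS_of_hasApprox {κ : MatrixClass} {m : ℕ} (hm : 0 < m)
    (hpow : ∀ (n t : ℕ) (A : Matrix (Fin n) (Fin n) ℚ), κ n A → κ (t * n) (blockPow t A))
    (hpos : ∀ (n : ℕ) (A : Matrix (Fin n) (Fin n) ℚ), κ n A → pZeroClass n A)
    {δ : ℝ} (hδ0 : 0 < δ) (hδ1 : δ < 1)
    (h : HasApprox κ m fun n => (2 : ℝ) ^ ((n : ℝ) ^ δ)) : HasFPRAS κ m := by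
  obtain ⟨p, c, d, hp⟩ := h
  obtain ⟨K, hKδ⟩ := exists_nat_ge (1 - δ)⁻¹
  obtain ⟨C, hC⟩ := exists_exec_rootProg κ m K p
  let N : ZInput κ m × ℚ → ℕ := fun i => 2 * (⌊1 / i.2⌋₊ + 1)
  let t : ZInput κ m × ℚ → ℕ := fun i => ((i.1.order + 1) * N i) ^ K
  let D : ZInput κ m × ℚ → ℕ := fun i => t i * i.1.order
  -- The time and bit bound of `p` on the power, with the size of the power estimated by
  -- `size_power_le`.
  let B : ZInput κ m × ℚ → ℕ := fun i => c * (m * (D i * D i * (i.1.size + 3)) + 1) ^ d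
  have key : ∀ X : ZInput κ m × ℚ → ℕ, (∀ i, i.1.size ≤ X i) → (∀ i, N i ≤ X i) →
      PolyBounded X t ∧ PolyBounded X D ∧ PolyBounded X B ∧
        PolyBounded X fun i => N i * (D i + 2 + B i) := by
    intro X hs hN
    have pn : PolyBounded X fun i => i.1.order :=
      .of_le fun i => (i.1.order_le_size hm).trans (hs i)
    have pt : PolyBounded X t := ((pn.add (.const X 1)).mul (.of_le hN)).pow K
    have pD : PolyBounded X D := pt.mul pn
    have pB : PolyBounded X B :=
      (PolyBounded.const X c).mul ((((PolyBounded.const X m).mul ((pD.mul pD).mul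
        ((PolyBounded.of_le hs).add (.const X 3)))).add (.const X 1)).pow d)
    exact ⟨pt, pD, pB, (PolyBounded.of_le hN).mul ((pD.add (.const X 2)).add pB)⟩
  obtain ⟨cT, dT, hT⟩ : ∃ c d : ℕ, ∀ i (x : ℝ), ((i.1.size + N i : ℕ) : ℝ) + 1 ≤ 3 * x →
      ((C * (D i * D i + t i + N i * (D i + 2 + B i) + 1) + B i : ℕ) : ℝ) ≤ c * x ^ d := by
    apply polyBounded_real (X := fun i : ZInput κ m × ℚ => i.1.size + N i)
    obtain ⟨pt, pD, pB, pk⟩ := key (fun i => i.1.size + N i) (fun i => by omega)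
      (fun i => by omega)
    exact ((PolyBounded.const _ C).mul ((((pD.mul pD).add pt).add pk).add (.const _ 1))).add pB
  -- Only the bit bound may involve the size of `ε`, which `ε⁻¹` does not control; the time bound
  -- above depends on `ε` through `N` alone.
  obtain ⟨cR, dR, hR⟩ : ∃ c d : ℕ, ∀ i (x : ℝ),
      ((i.1.size + N i + ratSize i.2 : ℕ) : ℝ) + 1 ≤ 3 * x →
      ((C * (i.1.size + ratSize i.2 + i.1.order + 2 + B i +
          (D i * D i * (D i * D i) * (i.1.order * i.1.order) + D i * D i * i.1.order +
            D i * D i + 2) +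
          (t i * (N i * (D i + 2 + B i)) + t i + N i * (D i + 2 + B i) + 2) *
            (2 * N i + 16)) : ℕ) : ℝ) ≤ c * x ^ d := by
    apply polyBounded_real (X := fun i : ZInput κ m × ℚ => i.1.size + N i + ratSize i.2)
    obtain ⟨pt, pD, pB, pk⟩ := key (fun i => i.1.size + N i + ratSize i.2) (fun i => by omega)
      (fun i => by omega)
    have ps : PolyBounded (fun i : ZInput κ m × ℚ => i.1.size + N i + ratSize i.2)
      fun i => i.1.size := .of_le fun i => by omega
    have pe : PolyBounded (fun i : ZInput κ m × ℚ => i.1.size + N i + ratSize i.2)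
      fun i => ratSize i.2 := .of_le fun i => by omega
    have pN : PolyBounded (fun i : ZInput κ m × ℚ => i.1.size + N i + ratSize i.2) N :=
      .of_le fun i => by omega
    have pn : PolyBounded (fun i : ZInput κ m × ℚ => i.1.size + N i + ratSize i.2)
      fun i => i.1.order := .of_le fun i => by have := i.1.order_le_size hm; omega
    exact (PolyBounded.const _ C).mul ((((((ps.add pe).add pn).add (.const _ 2)).add pB).add
      (((((pD.mul pD).mul (pD.mul pD)).mul (pn.mul pn)).add ((pD.mul pD).mul pn)).add
        (pD.mul pD) |>.add (.const _ 2))).add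
      ((((pt.mul pk).add pt).add pk).add (.const _ 2) |>.mul
        (((PolyBounded.const _ 2).mul pN).add (.const _ 16))))
  refine ⟨rootProg m K p, cT + cR, dT + dR, fun I ε hε0 hε1 => ?_⟩
  have hmem : ∀ i, κ (t (I, ε) * I.order) (blockPow (t (I, ε)) (I.mat i)) :=
    fun i => hpow _ _ _ (I.mem_class i)
  have hNq : (N (I, ε) : ℚ) = 2 * (⌊1 / ε⌋ + 1) := by
    simp only [N]
    push_cast
    rw [natCast_floor_eq_intCast_floor (by positivity)]
  have hN1 : 1 ≤ N (I, ε) := by simp only [N]; omega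
  have hNlow : 2 / (N (I, ε) : ℝ) ≤ ε := by
    have h1 : 1 / ε < ⌊1 / ε⌋₊ + 1 := Nat.lt_floor_add_one _
    have h2 : 1 / (ε : ℝ) < ⌊1 / ε⌋₊ + 1 := by exact_mod_cast h1
    have h3 : (0 : ℝ) < ε := by exact_mod_cast hε0
    rw [div_lt_iff₀ h3] at h2
    rw [div_le_iff₀ (by exact_mod_cast hN1)]
    simp only [N]; push_cast
    linarith
  have hNupp : (N (I, ε) : ℝ) ≤ 2 * (ε : ℝ)⁻¹ + 2 := by
    have h1 : (⌊1 / ε⌋₊ : ℚ) ≤ 1 / ε := Nat.floor_le (by positivity)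
    have h2 : (⌊1 / ε⌋₊ : ℝ) ≤ 1 / (ε : ℝ) := by exact_mod_cast h1
    rw [one_div (ε : ℝ)] at h2
    simp only [N]; push_cast
    linarith
  have hinv : (0 : ℝ) ≤ (ε : ℝ)⁻¹ := by
    have : (0 : ℝ) < ε := by exact_mod_cast hε0
    positivity
  obtain ⟨hhalt, hprob⟩ := hp (I.power (t (I, ε)) hmem)
  have hB : (c : ℝ) * (((I.power (t (I, ε)) hmem).size : ℝ) + 1) ^ d ≤ B (I, ε) := by
    have := Nat.mul_le_mul_left c (Nat.pow_le_pow_left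
      (Nat.add_le_add_right (I.size_power_le (t (I, ε)) hmem) 1) d)
    exact_mod_cast this
  -- For the same coins, success of `p` on the power implies success of `rootProg`, so the
  -- probability 3/4 carries over without amplification.
  refine ⟨fun ω => ?_, hprob.trans (measure_mono ?_)⟩
  · obtain ⟨t₀, b₀, s₀, hx, ht₀, hb₀⟩ := hhalt ω
    have ht₀' : t₀ ≤ B (I, ε) := by exact_mod_cast ht₀.trans hB
    have hb₀' : b₀ ≤ B (I, ε) := by exact_mod_cast hb₀.trans hB
    obtain ⟨k, t₁, b₁, s₁, hx₁, ht₁, hb₁, -⟩ := hC I ε (N (I, ε)) (t (I, ε)) (D (I, ε))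
      (B (I, ε)) ω hmem t₀ b₀ s₀ hNq hN1 rfl rfl hx hb₀'
    refine ⟨t₁, b₁, s₁, hx₁, ?_, ?_⟩
    · have h1 := hT (I, ε) ((I.size : ℝ) + (ε : ℝ)⁻¹ + 1) (by
        push_cast
        have : (0 : ℝ) ≤ I.size := Nat.cast_nonneg _
        linarith)
      have h2 := (Nat.cast_le (α := ℝ)).2 (ht₁.trans (Nat.add_le_add_left ht₀' _))
      refine (h2.trans h1).trans ?_
      have hx1 : (1 : ℝ) ≤ (I.size : ℝ) + (ε : ℝ)⁻¹ + 1 := by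
        have : (0 : ℝ) ≤ I.size := Nat.cast_nonneg _
        linarith
      push_cast
      exact mul_le_mul (by simp) (pow_le_pow_right₀ hx1 (by omega)) (by positivity) (by positivity)
    · have h1 := hR (I, ε) ((I.size : ℝ) + (ratSize ε : ℝ) + (ε : ℝ)⁻¹ + 1) (by
        push_cast
        have : (0 : ℝ) ≤ I.size := Nat.cast_nonneg _
        have : (0 : ℝ) ≤ ratSize ε := Nat.cast_nonneg _
        linarith)
      refine (((Nat.cast_le (α := ℝ)).2 hb₁).trans h1).trans ?_
      have hx1 : (1 : ℝ) ≤ (I.size : ℝ) + (ratSize ε : ℝ) + (ε : ℝ)⁻¹ + 1 := by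
        have : (0 : ℝ) ≤ I.size := Nat.cast_nonneg _
        have : (0 : ℝ) ≤ ratSize ε := Nat.cast_nonneg _
        linarith
      push_cast
      exact mul_le_mul (by simp) (pow_le_pow_right₀ hx1 (by omega)) (by positivity) (by positivity)
  · rintro ω ⟨t₀, b₀, s₀, hx, hlow, hupp⟩
    obtain ⟨k, t₁, b₁, s₁, hx₁, -, -, hy, hk1, hk2⟩ := hC I ε (N (I, ε)) (t (I, ε)) (D (I, ε))
      b₀ ω hmem t₀ b₀ s₀ hNq hN1 rfl rfl hx le_rfl
    rw [I.value_power] at hlow hupp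
    push_cast at hlow hupp
    have hZ : (1 : ℝ) ≤ I.value := by
      have : 1 ≤ I.value := one_le_normConst fun i => hpos _ _ (I.mem_class i)
      exact_mod_cast this
    have ht1 : 1 ≤ t (I, ε) := Nat.pow_pos (Nat.mul_pos (Nat.succ_pos _) hN1)
    have := root_approx hN1 hNlow ht1 (rpow_order_le hδ0 hδ1 hKδ (n := I.order) hN1 rfl) hZ
      hlow hupp (k := k)
      (fun j hj => by
        simpa only [Rat.cast_pow, Rat.cast_add, Rat.cast_one, Rat.cast_div, Rat.cast_natCast]
          using (Rat.cast_lt (K := ℝ)).2 (hk1 j hj))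
      (by
        simpa only [Rat.cast_pow, Rat.cast_add, Rat.cast_one, Rat.cast_div, Rat.cast_natCast]
          using (Rat.cast_le (K := ℝ)).2 hk2)
    refine ⟨t₁, b₁, s₁, hx₁, ?_⟩
    rw [hy]
    push_cast
    exact this

theorem mainTheorem12 (m : ℕ) (hm : 0 < m) :
    (HasFPRAS psdClass m ∨
      ∀ δ : ℝ, 0 < δ → δ < 1 →
        ¬ HasApprox psdClass m (fun n => (2 : ℝ) ^ ((n : ℝ) ^ δ))) ∧
    (HasFPRAS pZeroClass m ∨
      ∀ δ : ℝ, 0 < δ → δ < 1 →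
        ¬ HasApprox pZeroClass m (fun n => (2 : ℝ) ^ ((n : ℝ) ^ δ))) := by
  constructor <;> rw [or_iff_not_imp_left] <;> intro hF δ hδ0 hδ1 hA
  · exact hF (hasFPRAS_of_hasApprox hm (fun _ t _ h => psdClass_blockPow t h)
      (fun _ _ h => pZeroClass_of_psdClass h) hδ0 hδ1 hA)
  · exact hF (hasFPRAS_of_hasApprox hm (fun _ t _ h => pZeroClass_blockPow t h)
      (fun _ _ h => h) hδ0 hδ1 hA)
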